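/- Let $\mathbb D=\{|z|<1\}$ and $\mathbb T=\partial\mathbb D$. A holomorphic function element is a pair $(U,f)$ with $U\subset\mathbb C$ open and simply connected and $f:U\to\mathbb C$ holomorphic. Two elements are connectable if they are joined by a finite chain of elements in which consecutive domains meet and consecutive functions agree on the intersection of their domains. The boundary of $U$ is a natural boundary for $(U,f)$ if every element connectable to a restriction of $(U,f)$ has its domain contained in $U$. A regular analytic continuation of $(U,f)$ is a quadruple $(S,\pi,j,F)$, where $S$ is a connected Riemann surface, $\pi:S\to\mathbb C$ is a local biholomorphism, $j:U\to S$ is holomorphic with $\pi\circ j=\mathrm{id}_U$, and $F:S\to\mathbb C$ is holomorphic with $F\circ j=f$. It is maximal if for every other regular analytic continuation $(S',\pi',j',F')$ of $(U,f)$ there is a holomorphic map $\varphi:S'\to S$ with $\pi\circ\varphi=\pi'$, $\varphi\circ j'=j$ and $F\circ\varphi=F'$. Then the following holds. (0) There is a sequence $(a_n)_{n\ge 0}$ of pairwise distinct points of $\mathbb D$ such that $\sum_n(1-|a_n|)<\infty$, $(a_n)$ accumulates at every point of $\mathbb T$, and $|a_{2n}-a_{2n+1}|\le(1-|a_{2n}|)^2$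 for all $n$. Let $(a_n)$ be any such sequence. (1) With the constants $c_n=-|a_n|/a_n$ ($c_n=1$ if $a_n=0$) the Blaschke product $\prod_{n}c_n\frac{z-a_n}{1-\overline{a_n}z}$ converges uniformly on compact subsets of $\mathbb D$. Let $c_n$ be any constants with $|c_n|=1$ for which the partial products $\prod_{n<N}c_n\frac{z-a_n}{1-\overline{a_n}z}$ converge uniformly on compact subsets of $\mathbb D$ as $N\to\infty$, and let $B$ be the limit. (2) $B$ is holomorphic, $B(\mathbb D)\subset\mathbb D$, the zeros of $B$ in $\mathbb D$ are exactly the points $a_n$, all of them simple, and $\mathbb T$ is a natural boundary for $B$. (3) For every $n$ there is exactly one germ $f_n$ of a holomorphic function at $0$ with $f_n(0)=a_n$ and $B(f_n(w))=w$ near $0$. If $r_n$ denotes the radius of convergence of its Taylor series at $0$, then $f_n$ extends to an injective holomorphic map from $\{|w|<r_n\}$ into $\mathbb D$. Any two function elements that represent germs $f_m$ and $f_n$ at $0$ are connectable. (4) For every $n$, $$r_{2n}\le\frac{4|a_{2n}-a_{2n+1}|}{1-|a_{2n}|},\qquad r_{2n}\le 4(1-|a_{2n}|),$$ and $r_{2n}\to0$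 as $n\to\infty$. (5) For every $n$, every function element that represents the germ $f_n$ at $0$ has a maximal regular analytic continuation, and for every maximal regular analytic continuation $(S,\pi,j,F)$ of it the projection $\pi:S\to\pi(S)$ is not a topological covering. -/

import Mathlib

open scoped Manifold ContDiff Topology ENNReal

universe u

/-! ### Sequences in the unit disc and Blaschke products -/

/-- Pairwise distinct points `a n` of the open unit disc that satisfy the Blaschke condition,
accumulate at every point of the unit circle, and come in close pairs. -/
structure IsPairedBlaschkeSequence (a : ℕ → ℂ) : Prop where
  mem_disc : ∀ n, a n ∈ Metric.ball (0 : ℂ) 1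
  injective : Function.Injective a
  summable : Summable fun n => 1 - ‖a n‖
  accumulates : ∀ p ∈ Metric.sphere (0 : ℂ) 1, MapClusterPt p Filter.atTop a
  close : ∀ n, ‖a (2 * n) - a (2 * n + 1)‖ ≤ (1 - ‖a (2 * n)‖) ^ 2

/-- The `N`-th partial product of `∏ c n * (z - a n) / (1 - conj (a n) * z)`. -/
noncomputable def blaschkePartialProduct (a c : ℕ → ℂ) (N : ℕ) (z : ℂ) : ℂ :=
  ∏ n ∈ Finset.range N, c n * ((z - a n) / (1 - (starRingEnd ℂ) (a n) * z))

/-- `B` is, on the open unit disc, the Blaschke product with zeros `a n` and unimodular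
normalizing constants `c n`, the product converging uniformly on compact subsets. -/
def IsBlaschkeProduct (a c : ℕ → ℂ) (B : ℂ → ℂ) : Prop :=
  (∀ n, ‖c n‖ = 1) ∧
    TendstoLocallyUniformlyOn (blaschkePartialProduct a c) B Filter.atTop (Metric.ball 0 1)

/-- The customary normalizing constant `-|a| / a` (and `1` for `a = 0`). -/
noncomputable def blaschkeConst (a : ℂ) : ℂ :=
  if a = 0 then 1 else -((‖a‖ : ℂ) / a)

/-! ### Holomorphic function elements and analytic continuation -/

/-- A holomorphic function element `(U, f)`: `U` is a simply connected open subset of `ℂ` and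
`f` is holomorphic on `U` (values outside `U` are irrelevant). -/
structure HolElement where
  dom : TopologicalSpace.Opens ℂ
  simplyConnected : SimplyConnectedSpace dom
  toFun : ℂ → ℂ
  holo : DifferentiableOn ℂ toFun dom

namespace HolElement

/-- The domains meet and the functions agree on the intersection. -/
def Linked (E E' : HolElement) : Prop :=
  ((E.dom : Set ℂ) ∩ E'.dom).Nonempty ∧ Set.EqOn E.toFun E'.toFun ((E.dom : Set ℂ) ∩ E'.dom)

/-- `E` and `E'` are joined by a finite chain of successively linked elements. -/
def Connectable (E E' : HolElement) : Prop :=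
  Relation.ReflTransGen Linked E E'

/-- The boundary of the domain of `E` is a natural boundary: no analytic continuation of a
restriction of `E` leaves the domain of `E`. -/
def HasNaturalBoundary (E : HolElement) : Prop :=
  ∀ V W : HolElement, V.dom ≤ E.dom → Set.EqOn V.toFun E.toFun V.dom → Connectable V W →
    W.dom ≤ E.dom

/-- `E` is a branch of the inverse of `B` at `0` with value `b` at `0`. -/
def IsInverseBranch (B : ℂ → ℂ) (b : ℂ) (E : HolElement) : Prop :=
  (0 : ℂ) ∈ E.dom ∧ E.toFun 0 = b ∧ ∀ᶠ w in 𝓝 (0 : ℂ), B (E.toFun w) = w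

end HolElement

/-- The radius of convergence of the Taylor series of `f` at `z`. -/
noncomputable def taylorRadius (f : ℂ → ℂ) (z : ℂ) : ℝ≥0∞ :=
  (FormalMultilinearSeries.ofScalars ℂ
    (fun k : ℕ => ((k.factorial : ℂ)⁻¹ * iteratedDeriv k f z))).radius

/-- A regular analytic continuation `(S, π, j, F)` of the element `(U, f)`: a (connected,
Hausdorff) Riemann surface `S`, a local biholomorphism `π : S → ℂ` (onto its open image), a
holomorphic map `j : U → S` with `π ∘ j = id` and a holomorphic function `F : S → ℂ` with
`F ∘ j = f`. -/
structure RegularContinuation (E : HolElement) where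
  S : Type u
  [top : TopologicalSpace S]
  [t2 : T2Space S]
  [connected : ConnectedSpace S]
  [charted : ChartedSpace ℂ S]
  [manifold : IsManifold 𝓘(ℂ) ω S]
  proj : S → ℂ
  proj_local : IsLocalDiffeomorph 𝓘(ℂ) 𝓘(ℂ) ω proj
  incl : E.dom → S
  incl_holo : MDifferentiable 𝓘(ℂ) 𝓘(ℂ) incl
  proj_incl : ∀ z, proj (incl z) = z
  F : S → ℂ
  F_holo : MDifferentiable 𝓘(ℂ) 𝓘(ℂ) F
  F_incl : ∀ z, F (incl z) = E.toFun z

namespace RegularContinuation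

attribute [instance] top t2 connected charted manifold

/-- `Q` is maximal: every regular analytic continuation of the same element maps
holomorphically to `Q`, compatibly with all the data. (Such a map is unique, and a maximal
continuation is therefore unique up to isomorphism.) -/
def IsMaximal {E : HolElement} (Q : RegularContinuation.{u} E) : Prop :=
  ∀ Q' : RegularContinuation.{u} E, ∃ φ : Q'.S → Q.S,
    MDifferentiable 𝓘(ℂ) 𝓘(ℂ) φ ∧ (∀ s, Q.proj (φ s) = Q'.proj s) ∧
      (∀ z, φ (Q'.incl z) = Q.incl z) ∧ (∀ s, Q.F (φ s) = Q'.F s)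

/-- The projection of `Q` is a topological covering of its image. -/
def IsCovering {E : HolElement} (Q : RegularContinuation.{u} E) : Prop :=
  IsCoveringMap (Set.rangeFactorization Q.proj)

end RegularContinuation

/-!
The zeros of the Blaschke product `B` accumulate at every point of the circle, so a holomorphic
extension of a germ of `B` across a boundary point would vanish identically: the disc is a domain
of existence of `B`. Hence a holomorphic function which is locally a right inverse of `B` and is
defined on a connected open set takes all its values in the disc. Where its derivative does not
vanish this holds because its local inverse continues `B`; a critical point is excluded because
`B` is bounded near its value, so that the singularity of `B` there is removable.

Thus the branches of the inverse of `B` are parametrized by the set `R` of noncritical points of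
`B` in the disc. As `R` is connected, all branches are connectable; and `R`, with `B` as
projection, is the maximal continuation of each of them. By the Schwarz lemma applied to the factor
of `B` with zero `a m`, a branch `g` with `g 0 = a m` on the disc of radius `ρ` satisfies
`ρ ≤ ‖v 0‖` where `v` is the composition of `g` with any other factor, and the closely paired zeros
make this small. If `R → B(R)` were a covering, all branches at `0` would exist on a common disc.
-/
open Filter Metric Set

section Connectedness

variable {E : Type*} [NormedAddCommGroup E] [NormedSpace ℝ E]

theorem isPreconnected_ball_diff_singleton_of_one_lt_rank (hE : 1 < Module.rank ℝ E) (x : E)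
    (r : ℝ) : IsPreconnected (ball x r \ {x}) := by
  rcases le_or_gt r 0 with hr | hr
  · simp [ball_eq_empty.2 hr, isPreconnected_empty]
  have himage : OpenPartialHomeomorph.univBall x r '' {0}ᶜ = ball x r \ {x} := by
    have hinj : Function.Injective (OpenPartialHomeomorph.univBall x r) := by
      simpa using (OpenPartialHomeomorph.univBall x r).injOn
    have hrange : range (OpenPartialHomeomorph.univBall x r) = ball x r := by
      rw [← OpenPartialHomeomorph.univBall_target x hr, ← image_univ,
        ← OpenPartialHomeomorph.univBall_source x r, OpenPartialHomeomorph.image_source_eq_target]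
    rw [compl_eq_univ_sdiff, image_sdiff hinj, image_univ, hrange, image_singleton,
      OpenPartialHomeomorph.univBall_apply_zero]
  rw [← himage]
  exact (isConnected_compl_singleton_of_one_lt_rank hE 0).isPreconnected.image _
    (OpenPartialHomeomorph.continuous_univBall x r).continuousOn

theorem isPreconnected_of_subset_of_forall_mem_nhdsNE (hE : 1 < Module.rank ℝ E) {U C : Set E}
    (hU : IsPreconnected U) (hCU : C ⊆ U) (hC : ∀ x ∈ U, C ∈ 𝓝[≠] x) : IsPreconnected C := by
  have : Nontrivial E := rank_pos_iff_nontrivial.1 (one_pos.trans hE)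
  have hneBot : ∀ x : E, (𝓝[≠] x).NeBot := fun x => Module.punctured_nhds_neBot ℝ E x
  have hpair : ∀ x ∈ U, ∀ y ∈ U, ∃ T ⊆ C, IsPreconnected T ∧ T ∈ 𝓝[≠] x ∧ T ∈ 𝓝[≠] y := by
    intro x hx y hy
    refine hU.induction₂ (fun x y => ∃ T ⊆ C, IsPreconnected T ∧ T ∈ 𝓝[≠] x ∧ T ∈ 𝓝[≠] y)
      (fun x hx => ?_) ?_ ?_ hx hy
    · obtain ⟨r, hr, hrC⟩ := Metric.mem_nhdsWithin_iff.1 (hC x hx)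
      have hmem : ball x r \ {x} ∈ 𝓝[≠] x := sdiff_mem_nhdsWithin_compl (ball_mem_nhds x hr) _
      filter_upwards [mem_nhdsWithin_of_mem_nhds (ball_mem_nhds x hr)] with y hy
      refine ⟨_, hrC, isPreconnected_ball_diff_singleton_of_one_lt_rank hE x r, hmem, ?_⟩
      rcases eq_or_ne y x with rfl | hne
      · exact hmem
      · exact mem_nhdsWithin_of_mem_nhds ((isOpen_ball.sdiff isClosed_singleton).mem_nhds ⟨hy, hne⟩)
    · rintro x y z _ _ _ ⟨S, hSC, hS, hxS, hyS⟩ ⟨T, hTC, hT, hyT, hzT⟩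
      exact ⟨S ∪ T, union_subset hSC hTC, hS.union' (nonempty_of_mem (inter_mem hyS hyT)) hT,
        mem_of_superset hxS subset_union_left, mem_of_superset hzT subset_union_right⟩
    · rintro x y _ _ ⟨T, hTC, hT, hx, hy⟩
      exact ⟨T, hTC, hT, hy, hx⟩
  have hclosure : ∀ {x : E} {T : Set E}, T ∈ 𝓝[≠] x → x ∈ closure T := fun hT =>
    mem_closure_iff_nhdsWithin_neBot.2
      ((hneBot _).mono (le_inf inf_le_left (le_principal_iff.2 hT)))
  refine isPreconnected_of_forall_pair fun x hx y hy => ?_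
  obtain ⟨T, hTC, hT, hxT, hyT⟩ := hpair x (hCU hx) y (hCU hy)
  refine ⟨insert x (insert y T), ?_, by simp, by simp, hT.subset_closure ?_ ?_⟩
  · simp [insert_subset_iff, hx, hy, hTC]
  · exact (subset_insert _ _).trans (subset_insert _ _)
  · simp [insert_subset_iff, hclosure hxT, hclosure hyT, subset_closure]

end Connectedness

section IsolatedZeros

variable {U : Set ℂ} {h : ℂ → ℂ} (hh : DifferentiableOn ℂ h U) (hU : IsOpen U)
  (hUc : IsPreconnected U) (hne : ∃ z ∈ U, h z ≠ 0)

include hh hU hUc hne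

theorem eventually_nhdsNE_ne_zero_of_isPreconnected {z : ℂ} (hz : z ∈ U) :
    ∀ᶠ w in 𝓝[≠] z, h w ≠ 0 := by
  by_contra hfreq
  obtain ⟨z₁, hz₁, hne⟩ := hne
  exact hne ((hh.analyticOnNhd hU).eqOn_zero_of_preconnected_of_frequently_eq_zero hUc hz
    (by simpa only [Filter.Frequently] using hfreq) hz₁)

theorem isPreconnected_setOf_ne_zero : IsPreconnected {z ∈ U | h z ≠ 0} :=
  isPreconnected_of_subset_of_forall_mem_nhdsNE (by simp) hUc (sep_subset _ _) fun _ hz =>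
    Eventually.and (mem_nhdsWithin_of_mem_nhds (hU.mem_nhds hz))
      (eventually_nhdsNE_ne_zero_of_isPreconnected hh hU hUc hne hz)

end IsolatedZeros

section PairedSequence

theorem exists_seq_forall_mapClusterPt (X : Type*) [TopologicalSpace X]
    [TopologicalSpace.SeparableSpace X] [Nonempty X] :
    ∃ u : ℕ → X, ∀ p, MapClusterPt p atTop u := by
  refine ⟨fun n => TopologicalSpace.denseSeq X n.unpair.1, fun p => ?_⟩
  rw [mapClusterPt_iff_frequently]
  intro s hs
  obtain ⟨x, hxs, k, rfl⟩ :=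
    mem_closure_iff_nhds.1 (TopologicalSpace.denseRange_denseSeq X p) s hs
  exact frequently_atTop.2 fun N => ⟨Nat.pair k N, Nat.right_le_pair k N, by simpa using hxs⟩

theorem isPairedBlaschkeSequence_mul_of_gap {d : ℕ → ℝ} {u : ℕ → ℂ} (hd : ∀ m, d m ∈ Ioc 0 1)
    (hinj : Function.Injective d) (hsum : Summable d)
    (hclose : ∀ n, |d (2 * n) - d (2 * n + 1)| ≤ d (2 * n) ^ 2) (hu : ∀ n, ‖u n‖ = 1)
    (hcluster : ∀ p ∈ sphere (0 : ℂ) 1, MapClusterPt p atTop u) :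
    IsPairedBlaschkeSequence fun m => ((1 - d m : ℝ) : ℂ) * u (m / 2) := by
  have hnorm : ∀ m, ‖((1 - d m : ℝ) : ℂ) * u (m / 2)‖ = 1 - d m := fun m => by
    rw [norm_mul, hu, mul_one, Complex.norm_real, Real.norm_of_nonneg (sub_nonneg.2 (hd m).2)]
  have heven : ∀ n : ℕ, 2 * n / 2 = n := fun n => by omega
  have hodd : ∀ n : ℕ, (2 * n + 1) / 2 = n := fun n => by omega
  have hdouble : Tendsto (fun n : ℕ => 2 * n) atTop atTop := tendsto_id.const_mul_atTop' two_pos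
  refine ⟨fun m => ?_, fun m n h => hinj ?_, by simpa only [hnorm, sub_sub_cancel] using hsum,
    fun p hp => ?_, fun n => ?_⟩
  · rw [mem_ball_zero_iff, hnorm]
    linarith [(hd m).1]
  · have := congrArg norm h
    simp only [hnorm] at this
    linarith
  · refine MapClusterPt.of_comp hdouble ?_
    obtain ⟨V, hV, hVu⟩ := mapClusterPt_iff_ultrafilter.1 (hcluster p hp)
    have hlim : Tendsto (fun n => ((1 - d (2 * n) : ℝ) : ℂ)) V (𝓝 1) := by
      have := ((hsum.tendsto_atTop_zero.comp hdouble).const_sub 1).mono_left hV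
      simpa only [Function.comp_def, sub_zero, Complex.ofReal_one] using this.ofReal
    refine mapClusterPt_iff_ultrafilter.2 ⟨V, hV, ?_⟩
    simpa only [Function.comp_def, heven, one_mul] using hlim.mul hVu
  · have hdiff : ((1 - d (2 * n) : ℝ) : ℂ) * u n - ((1 - d (2 * n + 1) : ℝ) : ℂ) * u n =
        ((d (2 * n + 1) - d (2 * n) : ℝ) : ℂ) * u n := by
      push_cast
      ring
    rw [hnorm, heven, hodd, hdiff, norm_mul, hu, mul_one, Complex.norm_real, Real.norm_eq_abs,
      sub_sub_cancel, abs_sub_comm]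
    exact hclose n

/-- The distances `1/2, 1/3; 1/4, 1/5; 1/8, 1/9; …` to the unit circle in the construction of a
paired Blaschke sequence: the terms of the `n`-th pair are `1 / k` and `1 / (k + 1)` with
`k = 2 ^ (n + 1)`, and `1 / k - 1 / (k + 1) ≤ (1 / k) ^ 2`. -/
noncomputable def pairedGap (m : ℕ) : ℝ :=
  ((2 ^ (m / 2 + 1) + m % 2 : ℕ) : ℝ)⁻¹

theorem pairedGap_mem_Ioc (m : ℕ) : pairedGap m ∈ Ioc 0 1 := by
  have h : 1 ≤ 2 ^ (m / 2 + 1) + m % 2 := Nat.le_add_right_of_le Nat.one_le_two_pow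
  exact ⟨inv_pos.2 (by exact_mod_cast h), inv_le_one_of_one_le₀ (by exact_mod_cast h)⟩

theorem injective_pairedGap : Function.Injective pairedGap := by
  intro m n h
  have hden : 2 ^ (m / 2 + 1) + m % 2 = 2 ^ (n / 2 + 1) + n % 2 := by
    exact_mod_cast inv_injective h
  rw [pow_succ, pow_succ] at hden
  have hmod : m % 2 = n % 2 := by omega
  have hdiv : m / 2 = n / 2 := Nat.pow_right_injective le_rfl (by omega : 2 ^ (m / 2) = 2 ^ (n / 2))
  omega

theorem pairedGap_even (n : ℕ) : pairedGap (2 * n) = (2 ^ (n + 1))⁻¹ := by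
  simp [pairedGap]

theorem pairedGap_odd (n : ℕ) : pairedGap (2 * n + 1) = (2 ^ (n + 1) + 1)⁻¹ := by
  have h : (2 * n + 1) / 2 = n := by omega
  simp [pairedGap, h, Nat.add_mod]

theorem summable_pairedGap : Summable pairedGap := by
  have heven : Summable fun n => pairedGap (2 * n) := by
    simp only [pairedGap_even, ← inv_pow]
    exact (summable_nat_add_iff 1).2 (summable_geometric_of_lt_one (by norm_num) (by norm_num))
  have hodd : Summable fun n => pairedGap (2 * n + 1) := by
    refine heven.of_nonneg_of_le (fun n => (pairedGap_mem_Ioc _).1.le) fun n => ?_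
    rw [pairedGap_even, pairedGap_odd]
    gcongr
    linarith
  exact (heven.hasSum.even_add_odd hodd.hasSum).summable

theorem abs_pairedGap_even_sub_odd_le (n : ℕ) :
    |pairedGap (2 * n) - pairedGap (2 * n + 1)| ≤ pairedGap (2 * n) ^ 2 := by
  rw [pairedGap_even, pairedGap_odd]
  have hk : (0 : ℝ) < 2 ^ (n + 1) := by positivity
  generalize (2 : ℝ) ^ (n + 1) = k at hk
  have hsub : k⁻¹ - (k + 1)⁻¹ = k⁻¹ * (k + 1)⁻¹ := by
    field_simp
    ring
  rw [hsub, abs_of_pos (by positivity), sq]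
  gcongr
  linarith

theorem exists_isPairedBlaschkeSequence : ∃ a : ℕ → ℂ, IsPairedBlaschkeSequence a := by
  have : Nonempty (sphere (0 : ℂ) 1) := (NormedSpace.sphere_nonempty.2 zero_le_one).to_subtype
  obtain ⟨u, hu⟩ := exists_seq_forall_mapClusterPt (sphere (0 : ℂ) 1)
  exact ⟨_, isPairedBlaschkeSequence_mul_of_gap pairedGap_mem_Ioc injective_pairedGap
    summable_pairedGap abs_pairedGap_even_sub_odd_le (fun n => mem_sphere_zero_iff_norm.1 (u n).2)
    fun p hp => (hu ⟨p, hp⟩).continuousAt_comp continuous_subtype_val.continuousAt⟩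

end PairedSequence

section BlaschkeFactor

/-- The automorphism `z ↦ (z - a) / (1 - conj a * z)` of the unit disc (for `‖a‖ < 1`) that takes
`a` to `0`. -/
noncomputable def blaschkeFactor (a z : ℂ) : ℂ :=
  (z - a) / (1 - (starRingEnd ℂ) a * z)

variable {a z : ℂ}

theorem one_sub_norm_le_norm_one_sub_conj_mul (ha : ‖a‖ ≤ 1) :
    1 - ‖z‖ ≤ ‖1 - (starRingEnd ℂ) a * z‖ := by
  have hle : ‖(starRingEnd ℂ) a * z‖ ≤ ‖z‖ := by
    rw [norm_mul, RCLike.norm_conj]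
    exact mul_le_of_le_one_left (norm_nonneg _) ha
  have htriangle := norm_sub_norm_le (1 : ℂ) ((starRingEnd ℂ) a * z)
  rw [norm_one] at htriangle
  linarith

theorem one_sub_conj_mul_ne_zero (ha : ‖a‖ ≤ 1) (hz : ‖z‖ < 1) :
    1 - (starRingEnd ℂ) a * z ≠ 0 := by
  rw [← norm_pos_iff]
  linarith [one_sub_norm_le_norm_one_sub_conj_mul (z := z) ha]

theorem sq_norm_one_sub_conj_mul_sub_sq_norm_sub (a z : ℂ) :
    ‖1 - (starRingEnd ℂ) a * z‖ ^ 2 - ‖z - a‖ ^ 2 = (1 - ‖a‖ ^ 2) * (1 - ‖z‖ ^ 2) := by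
  simp only [← Complex.normSq_eq_norm_sq, Complex.normSq_apply, Complex.sub_re, Complex.sub_im,
    Complex.mul_re, Complex.mul_im, Complex.conj_re, Complex.conj_im, Complex.one_re,
    Complex.one_im]
  ring

theorem one_sub_sq_norm_blaschkeFactor (ha : ‖a‖ ≤ 1) (hz : ‖z‖ < 1) :
    1 - ‖blaschkeFactor a z‖ ^ 2 =
      (1 - ‖a‖ ^ 2) * (1 - ‖z‖ ^ 2) / ‖1 - (starRingEnd ℂ) a * z‖ ^ 2 := by
  have h := norm_ne_zero_iff.2 (one_sub_conj_mul_ne_zero ha hz)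
  rw [blaschkeFactor, norm_div, ← sq_norm_one_sub_conj_mul_sub_sq_norm_sub, div_pow, sub_div,
    div_self (pow_ne_zero 2 h)]

theorem norm_blaschkeFactor_lt_one (ha : ‖a‖ < 1) (hz : ‖z‖ < 1) : ‖blaschkeFactor a z‖ < 1 := by
  have hden := norm_pos_iff.2 (one_sub_conj_mul_ne_zero ha.le hz)
  have hpos : 0 < 1 - ‖blaschkeFactor a z‖ ^ 2 := by
    rw [one_sub_sq_norm_blaschkeFactor ha.le hz]
    have ha2 : 0 < 1 - ‖a‖ ^ 2 := sub_pos.2 (pow_lt_one₀ (norm_nonneg a) ha two_ne_zero)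
    have hz2 : 0 < 1 - ‖z‖ ^ 2 := sub_pos.2 (pow_lt_one₀ (norm_nonneg z) hz two_ne_zero)
    positivity
  exact (sq_lt_one_iff₀ (norm_nonneg _)).1 (sub_pos.1 hpos)

theorem one_sub_norm_blaschkeFactor_le (ha : ‖a‖ < 1) (hz : ‖z‖ < 1) :
    1 - ‖blaschkeFactor a z‖ ≤ 2 / (1 - ‖z‖) ^ 2 * (1 - ‖a‖) := by
  have hden := one_sub_norm_le_norm_one_sub_conj_mul (z := z) ha.le
  have : 0 < 1 - ‖z‖ := sub_pos.2 hz
  have hnum : (1 - ‖a‖ ^ 2) * (1 - ‖z‖ ^ 2) ≤ 2 * (1 - ‖a‖) := by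
    have ha2 : 0 ≤ 1 - ‖a‖ ^ 2 := sub_nonneg.2 (pow_le_one₀ (norm_nonneg a) ha.le)
    calc (1 - ‖a‖ ^ 2) * (1 - ‖z‖ ^ 2) ≤ 1 - ‖a‖ ^ 2 :=
          mul_le_of_le_one_right ha2 (by linarith [sq_nonneg ‖z‖])
      _ ≤ 2 * (1 - ‖a‖) := by linarith [sq_nonneg (1 - ‖a‖)]
  calc 1 - ‖blaschkeFactor a z‖ ≤ 1 - ‖blaschkeFactor a z‖ ^ 2 :=
        sub_le_sub_left (sq_le (norm_nonneg _) (norm_blaschkeFactor_lt_one ha hz).le) 1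
    _ = (1 - ‖a‖ ^ 2) * (1 - ‖z‖ ^ 2) / ‖1 - (starRingEnd ℂ) a * z‖ ^ 2 :=
        one_sub_sq_norm_blaschkeFactor ha.le hz
    _ ≤ (2 * (1 - ‖a‖)) / (1 - ‖z‖) ^ 2 := by
        have := sub_pos.2 ha
        gcongr
    _ = 2 / (1 - ‖z‖) ^ 2 * (1 - ‖a‖) := by ring

theorem blaschkeFactor_self (a : ℂ) : blaschkeFactor a a = 0 := by
  simp [blaschkeFactor]

theorem blaschkeFactor_eq_zero_iff (ha : ‖a‖ ≤ 1) (hz : ‖z‖ < 1) :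
    blaschkeFactor a z = 0 ↔ z = a := by
  simp [blaschkeFactor, div_eq_zero_iff, one_sub_conj_mul_ne_zero ha hz, sub_eq_zero]

theorem differentiableOn_blaschkeFactor (ha : ‖a‖ ≤ 1) :
    DifferentiableOn ℂ (blaschkeFactor a) (ball 0 1) := by
  refine DifferentiableOn.div (by fun_prop) (by fun_prop) fun z hz => ?_
  exact one_sub_conj_mul_ne_zero ha (mem_ball_zero_iff.1 hz)

theorem one_le_norm_deriv_blaschkeFactor_self (ha : ‖a‖ < 1) :
    1 ≤ ‖deriv (blaschkeFactor a) a‖ := by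
  have hden := one_sub_conj_mul_ne_zero ha.le ha
  have hderiv : deriv (blaschkeFactor a) a = (1 - (starRingEnd ℂ) a * a)⁻¹ := by
    have hnum : HasDerivAt (fun z => z - a) 1 a := (hasDerivAt_id a).sub_const a
    have h := hnum.div (((hasDerivAt_id a).const_mul ((starRingEnd ℂ) a)).const_sub 1) hden
    refine (h.congr_deriv ?_).deriv
    simp only [id, sub_self, zero_mul, sub_zero, one_mul]
    field_simp
  have hreal : 1 - (starRingEnd ℂ) a * a = ((1 - ‖a‖ ^ 2 : ℝ) : ℂ) := by
    rw [mul_comm, Complex.mul_conj, Complex.normSq_eq_norm_sq]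
    push_cast
    rfl
  have hle : ‖1 - (starRingEnd ℂ) a * a‖ ≤ 1 := by
    have : 0 ≤ 1 - ‖a‖ ^ 2 := sub_nonneg.2 (pow_le_one₀ (norm_nonneg a) ha.le)
    rw [hreal, Complex.norm_real, Real.norm_of_nonneg this]
    linarith [sq_nonneg ‖a‖]
  rw [hderiv, norm_inv]
  exact one_le_inv₀ (norm_pos_iff.2 hden) |>.2 hle

theorem norm_blaschkeConst (a : ℂ) : ‖blaschkeConst a‖ = 1 := by
  by_cases h : a = 0 <;> simp [blaschkeConst, h]

theorem blaschkeConst_mul_blaschkeFactor_sub_one (ha : a ≠ 0)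
    (hz : 1 - (starRingEnd ℂ) a * z ≠ 0) :
    blaschkeConst a * blaschkeFactor a z - 1 =
      -((1 - (‖a‖ : ℂ)) * (a + ‖a‖ * z) / (a * (1 - (starRingEnd ℂ) a * z))) := by
  have hnorm : (starRingEnd ℂ) a * a = (‖a‖ : ℂ) ^ 2 := by
    rw [mul_comm, Complex.mul_conj, Complex.normSq_eq_norm_sq]
    push_cast
    rfl
  rw [blaschkeConst, if_neg ha, blaschkeFactor]
  generalize hw : 1 - (starRingEnd ℂ) a * z = w at hz ⊢
  field_simp
  linear_combination a * hw + z * hnorm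

theorem norm_blaschkeConst_mul_blaschkeFactor_sub_one_le (ha : ‖a‖ < 1) (hz : ‖z‖ < 1) :
    ‖blaschkeConst a * blaschkeFactor a z - 1‖ ≤ 2 / (1 - ‖z‖) * (1 - ‖a‖) := by
  have hz' : 0 < 1 - ‖z‖ := sub_pos.2 hz
  rcases eq_or_ne a 0 with rfl | h0
  · have hle : ‖z - 1‖ ≤ 2 := (norm_sub_le _ _).trans (by rw [norm_one]; linarith)
    simp only [blaschkeConst, if_true, blaschkeFactor, map_zero, zero_mul, sub_zero, div_one,
      one_mul, norm_zero, mul_one]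
    exact hle.trans (le_div_self zero_le_two hz' (by linarith [norm_nonneg z]))
  have ha' : 0 < 1 - ‖a‖ := sub_pos.2 ha
  have hnorm : ‖(1 - (‖a‖ : ℂ))‖ = 1 - ‖a‖ := by
    rw [← Complex.ofReal_one, ← Complex.ofReal_sub, Complex.norm_real, Real.norm_of_nonneg ha'.le]
  have hnum : ‖a + ‖a‖ * z‖ ≤ ‖a‖ * 2 := by
    refine (norm_add_le _ _).trans ?_
    rw [norm_mul, Complex.norm_real, norm_norm]
    nlinarith [norm_nonneg a]
  have hden := one_sub_norm_le_norm_one_sub_conj_mul (z := z) ha.le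
  have : 0 < ‖a‖ := norm_pos_iff.2 h0
  rw [blaschkeConst_mul_blaschkeFactor_sub_one h0 (one_sub_conj_mul_ne_zero ha.le hz), norm_neg,
    norm_div, norm_mul, norm_mul, hnorm]
  calc (1 - ‖a‖) * ‖a + ‖a‖ * z‖ / (‖a‖ * ‖1 - (starRingEnd ℂ) a * z‖)
      ≤ (1 - ‖a‖) * (‖a‖ * 2) / (‖a‖ * (1 - ‖z‖)) := by gcongr
    _ = 2 / (1 - ‖z‖) * (1 - ‖a‖) := by field_simp

theorem norm_blaschkeFactor_le_div {b : ℂ} (ha : ‖a‖ < 1) (hb : ‖b‖ ≤ 1) :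
    ‖blaschkeFactor b a‖ ≤ ‖a - b‖ / (1 - ‖a‖) := by
  rw [blaschkeFactor, norm_div]
  have : 0 < 1 - ‖a‖ := sub_pos.2 ha
  gcongr
  exact one_sub_norm_le_norm_one_sub_conj_mul hb

end BlaschkeFactor

section BlaschkeProduct

theorem exists_pos_le_finset_prod {ι : Type*} {x : ι → ℝ} (hpos : ∀ n, 0 < x n)
    (hle : ∀ n, x n ≤ 1) (hsum : Summable fun n => 1 - x n) :
    ∃ δ > 0, ∀ s : Finset ι, δ ≤ ∏ n ∈ s, x n := by
  have hlog : Summable fun n => -Real.log (x n) := by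
    have := Real.summable_log_one_add_of_summable (f := fun n => x n - 1)
      (by simpa only [neg_sub] using hsum.neg)
    simpa only [add_sub_cancel] using this.neg
  refine ⟨Real.exp (-∑' n, -Real.log (x n)), Real.exp_pos _, fun s => ?_⟩
  have h := hlog.sum_le_tsum s fun n _ => neg_nonneg.2 (Real.log_nonpos (hpos n).le (hle n))
  calc Real.exp (-∑' n, -Real.log (x n)) ≤ Real.exp (∑ n ∈ s, Real.log (x n)) := by
        rw [Finset.sum_neg_distrib] at h
        exact Real.exp_le_exp.2 (by linarith)
    _ = ∏ n ∈ s, x n := by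
        rw [Real.exp_sum]
        exact Finset.prod_congr rfl fun n _ => Real.exp_log (hpos n)

theorem exists_pos_le_prod_norm_blaschkeFactor {ι : Type*} {a : ι → ℂ} (ha : ∀ n, ‖a n‖ < 1)
    (hsum : Summable fun n => 1 - ‖a n‖) {z : ℂ} (hz : ‖z‖ < 1) :
    ∃ δ > 0, ∀ s : Finset ι, (∀ n ∈ s, a n ≠ z) → δ ≤ ∏ n ∈ s, ‖blaschkeFactor (a n) z‖ := by
  classical
  have hle : ∀ n, ‖blaschkeFactor (a n) z‖ ≤ 1 := fun n => (norm_blaschkeFactor_lt_one (ha n) hz).le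
  have hpos : ∀ n : {n // a n ≠ z}, 0 < ‖blaschkeFactor (a n) z‖ := fun n =>
    norm_pos_iff.2 fun h => n.2 ((blaschkeFactor_eq_zero_iff (ha n).le hz).1 h).symm
  have hsum' : Summable fun n => 1 - ‖blaschkeFactor (a n) z‖ :=
    (hsum.mul_left _).of_nonneg_of_le (fun n => sub_nonneg.2 (hle n)) fun n =>
      one_sub_norm_blaschkeFactor_le (ha n) hz
  obtain ⟨δ, hδ, h⟩ :=
    exists_pos_le_finset_prod hpos (fun n => hle n) (hsum'.subtype {n | a n ≠ z})
  refine ⟨δ, hδ, fun s hs => ?_⟩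
  simpa only [Finset.prod_subtype_of_mem (fun n => ‖blaschkeFactor (a n) z‖) hs]
    using h (s.subtype fun n => a n ≠ z)

variable {a c : ℕ → ℂ} {B : ℂ → ℂ}

theorem blaschkePartialProduct_eq (a c : ℕ → ℂ) (N : ℕ) (z : ℂ) :
    blaschkePartialProduct a c N z = ∏ n ∈ Finset.range N, c n * blaschkeFactor (a n) z :=
  rfl

theorem differentiableOn_blaschkePartialProduct (ha : ∀ n, ‖a n‖ < 1) (c : ℕ → ℂ) (N : ℕ) :
    DifferentiableOn ℂ (blaschkePartialProduct a c N) (ball 0 1) :=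
  DifferentiableOn.fun_finsetProd fun n _ =>
    (differentiableOn_blaschkeFactor (ha n).le).const_mul (c n)

theorem norm_deriv_blaschkePartialProduct (ha : ∀ n, ‖a n‖ < 1) (hc : ∀ n, ‖c n‖ = 1) {n N : ℕ}
    (hn : n < N) :
    ‖deriv (blaschkePartialProduct a c N) (a n)‖ =
      ‖deriv (blaschkeFactor (a n)) (a n)‖ *
        ∏ k ∈ (Finset.range N).erase n, ‖blaschkeFactor (a k) (a n)‖ := by
  have hdiff : ∀ k, DifferentiableAt ℂ (fun z => c k * blaschkeFactor (a k) z) (a n) := fun k =>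
    ((differentiableOn_blaschkeFactor (ha k).le).differentiableAt
      (isOpen_ball.mem_nhds (mem_ball_zero_iff.2 (ha n)))).const_mul (c k)
  have hsplit : blaschkePartialProduct a c N = fun z => c n * blaschkeFactor (a n) z *
      ∏ k ∈ (Finset.range N).erase n, c k * blaschkeFactor (a k) z := by
    ext z
    exact (Finset.mul_prod_erase _ (fun k => c k * blaschkeFactor (a k) z)
      (Finset.mem_range.2 hn)).symm
  rw [hsplit, deriv_fun_mul (hdiff n) (DifferentiableAt.fun_finsetProd fun k _ => hdiff k),
    blaschkeFactor_self, mul_zero, zero_mul, add_zero, deriv_const_mul_field']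
  simp only [norm_mul, norm_prod, hc, one_mul]

theorem exists_isBlaschkeProduct (ha : ∀ n, ‖a n‖ < 1) (hsum : Summable fun n => 1 - ‖a n‖) :
    ∃ B : ℂ → ℂ, IsBlaschkeProduct a (fun n => blaschkeConst (a n)) B := by
  let f : ℕ → ℂ → ℂ := fun n z => blaschkeConst (a n) * blaschkeFactor (a n) z - 1
  have hprod : HasProdLocallyUniformlyOn (fun n z => 1 + f n z) (fun z => ∏' n, (1 + f n z))
      (ball 0 1) := by
    refine hasProdLocallyUniformlyOn_of_forall_compact isOpen_ball fun K hK hKc => ?_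
    obtain ⟨r, hr, hKr⟩ : ∃ r < (1 : ℝ), K ⊆ ball 0 r := exists_lt_subset_ball hKc.isClosed hK
    refine Summable.hasProdUniformlyOn_nat_one_add hKc
      (hsum.mul_left (2 / (1 - r))) (Eventually.of_forall fun n z hz => ?_) fun n => ?_
    · have hzr : ‖z‖ < r := mem_ball_zero_iff.1 (hKr hz)
      refine (norm_blaschkeConst_mul_blaschkeFactor_sub_one_le (ha n) (hzr.trans hr)).trans ?_
      have := sub_pos.2 (ha n)
      have := sub_pos.2 hr
      gcongr
    · exact (((differentiableOn_blaschkeFactor (ha n).le).continuousOn.mono hK).const_mul _).sub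
        continuousOn_const
  refine ⟨fun z => ∏' n, (1 + f n z), fun n => norm_blaschkeConst (a n), ?_⟩
  refine hprod.tendstoLocallyUniformlyOn_finsetRange.congr fun N z _ => ?_
  simp only [f, blaschkePartialProduct_eq, add_sub_cancel]

namespace IsBlaschkeProduct

theorem tendsto_norm (hB : IsBlaschkeProduct a c B) {z : ℂ} (hz : ‖z‖ < 1) :
    Tendsto (fun N => ∏ n ∈ Finset.range N, ‖blaschkeFactor (a n) z‖) atTop (𝓝 ‖B z‖) := by
  simpa only [blaschkePartialProduct_eq, norm_prod, norm_mul, hB.1, one_mul]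
    using (hB.2.tendsto_at (mem_ball_zero_iff.2 hz)).norm

theorem differentiableOn (hB : IsBlaschkeProduct a c B) (ha : ∀ n, ‖a n‖ < 1) :
    DifferentiableOn ℂ B (ball 0 1) :=
  hB.2.differentiableOn (Eventually.of_forall (differentiableOn_blaschkePartialProduct ha c))
    isOpen_ball

theorem norm_le_prod (hB : IsBlaschkeProduct a c B) (ha : ∀ n, ‖a n‖ < 1) {z : ℂ} (hz : ‖z‖ < 1)
    (s : Finset ℕ) : ‖B z‖ ≤ ∏ n ∈ s, ‖blaschkeFactor (a n) z‖ := by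
  refine le_of_tendsto (hB.tendsto_norm hz) ?_
  obtain ⟨M, hM⟩ := s.exists_nat_subset_range
  filter_upwards [eventually_ge_atTop M] with N hN
  exact Finset.prod_le_prod_of_subset_of_le_one (hM.trans (Finset.range_mono hN))
    (fun n _ => norm_nonneg _) fun n _ _ => (norm_blaschkeFactor_lt_one (ha n) hz).le

theorem norm_le_mul (hB : IsBlaschkeProduct a c B) (ha : ∀ n, ‖a n‖ < 1) {z : ℂ} (hz : ‖z‖ < 1)
    {m n : ℕ} (hmn : m ≠ n) :
    ‖B z‖ ≤ ‖blaschkeFactor (a m) z‖ * ‖blaschkeFactor (a n) z‖ := by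
  simpa only [Finset.prod_pair hmn] using hB.norm_le_prod ha hz {m, n}

theorem mapsTo_ball (hB : IsBlaschkeProduct a c B) (ha : ∀ n, ‖a n‖ < 1) :
    MapsTo B (ball 0 1) (ball 0 1) := by
  intro z hz
  have hz' : ‖z‖ < 1 := mem_ball_zero_iff.1 hz
  have h := hB.norm_le_prod ha hz' {0}
  rw [Finset.prod_singleton] at h
  exact mem_ball_zero_iff.2 (h.trans_lt (norm_blaschkeFactor_lt_one (ha 0) hz'))

theorem apply_eq_zero (hB : IsBlaschkeProduct a c B) (ha : ∀ n, ‖a n‖ < 1) (n : ℕ) :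
    B (a n) = 0 := by
  simpa [blaschkeFactor_self] using hB.norm_le_prod ha (ha n) {n}

theorem apply_eq_zero_iff (hB : IsBlaschkeProduct a c B) (ha : ∀ n, ‖a n‖ < 1)
    (hsum : Summable fun n => 1 - ‖a n‖) {z : ℂ} (hz : ‖z‖ < 1) : B z = 0 ↔ ∃ n, a n = z := by
  refine ⟨fun h => ?_, ?_⟩
  · by_contra! hne
    obtain ⟨δ, hδ, hbound⟩ := exists_pos_le_prod_norm_blaschkeFactor ha hsum hz
    have hle := ge_of_tendsto' (hB.tendsto_norm hz) fun N => hbound _ fun n _ => hne n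
    rw [h, norm_zero] at hle
    exact hle.not_gt hδ
  · rintro ⟨n, rfl⟩
    exact hB.apply_eq_zero ha n

theorem deriv_ne_zero (hB : IsBlaschkeProduct a c B) (ha : ∀ n, ‖a n‖ < 1)
    (hsum : Summable fun n => 1 - ‖a n‖) (hinj : Function.Injective a) (n : ℕ) :
    deriv B (a n) ≠ 0 := by
  have hlim : Tendsto (fun N => deriv (blaschkePartialProduct a c N) (a n)) atTop
      (𝓝 (deriv B (a n))) :=
    (hB.2.deriv (Eventually.of_forall (differentiableOn_blaschkePartialProduct ha c))
      isOpen_ball).tendsto_at (mem_ball_zero_iff.2 (ha n))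
  obtain ⟨δ, hδ, hbound⟩ := exists_pos_le_prod_norm_blaschkeFactor ha hsum (ha n)
  have hge : ∀ᶠ N in atTop, δ ≤ ‖deriv (blaschkePartialProduct a c N) (a n)‖ := by
    filter_upwards [eventually_gt_atTop n] with N hN
    rw [norm_deriv_blaschkePartialProduct ha hB.1 hN]
    refine (hbound ((Finset.range N).erase n) fun k hk =>
      hinj.ne (Finset.ne_of_mem_erase hk)).trans ?_
    exact le_mul_of_one_le_left (Finset.prod_nonneg fun _ _ => norm_nonneg _)
      (one_le_norm_deriv_blaschkeFactor_self (ha n))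
  exact norm_pos_iff.1 (hδ.trans_le (ge_of_tendsto hlim.norm hge))

end IsBlaschkeProduct

end BlaschkeProduct

section InverseFunction

theorem eventuallyEq_symm_of_eventually_comp_eq {X Y : Type*} [TopologicalSpace X]
    [TopologicalSpace Y] (e : OpenPartialHomeomorph X Y) {x : X} (hx : x ∈ e.source) {g : Y → X}
    (hg : ContinuousAt g (e x)) (hgx : g (e x) = x) (heg : ∀ᶠ y in 𝓝 (e x), e (g y) = y) :
    g =ᶠ[𝓝 (e x)] e.symm := by
  have hsource : ∀ᶠ y in 𝓝 (e x), g y ∈ e.source :=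
    hg.eventually (by rw [hgx]; exact e.open_source.mem_nhds hx)
  filter_upwards [hsource, heg] with y hy hey
  rw [← e.left_inv hy, hey]

theorem exists_openPartialHomeomorph_of_deriv_ne_zero {U : Set ℂ} {f : ℂ → ℂ}
    (hf : DifferentiableOn ℂ f U) (hU : IsOpen U) {z : ℂ} (hz : z ∈ U) (hd : deriv f z ≠ 0) :
    ∃ e : OpenPartialHomeomorph ℂ ℂ, z ∈ e.source ∧ e.source ⊆ {w ∈ U | deriv f w ≠ 0} ∧
      ⇑e = f ∧ DifferentiableOn ℂ e.symm e.target := by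
  have han : AnalyticAt ℂ f z := hf.analyticAt (hU.mem_nhds hz)
  have hopen : IsOpen {w ∈ U | deriv f w ≠ 0} :=
    (hf.deriv hU).continuousOn.isOpen_inter_preimage hU isOpen_compl_singleton
  let e₀ := (han.hasStrictDerivAt.hasStrictFDerivAt_equiv hd).toOpenPartialHomeomorph f
  let e := e₀.restrOpen _ hopen
  have hsource : e.source ⊆ {w ∈ U | deriv f w ≠ 0} := inter_subset_right
  refine ⟨e, ⟨HasStrictFDerivAt.mem_toOpenPartialHomeomorph_source _, hz, hd⟩, hsource, rfl,
    fun w hw => ?_⟩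
  have hw' := hsource (e.map_target hw)
  exact (e.hasDerivAt_symm hw hw'.2
    (hf.hasDerivAt (hU.mem_nhds hw'.1))).differentiableAt.differentiableWithinAt

theorem deriv_ne_zero_of_eventually_comp_eq {B g : ℂ → ℂ} {w : ℂ}
    (hB : DifferentiableAt ℂ B (g w)) (hg : DifferentiableAt ℂ g w)
    (h : ∀ᶠ x in 𝓝 w, B (g x) = x) : deriv B (g w) ≠ 0 ∧ deriv g w ≠ 0 := by
  have hcomp : HasDerivAt (fun x => B (g x)) (deriv B (g w) * deriv g w) w :=
    hB.hasDerivAt.comp w hg.hasDerivAt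
  have hone := hcomp.unique ((hasDerivAt_id w).congr_of_eventuallyEq h)
  exact mul_ne_zero_iff.1 (hone ▸ one_ne_zero)

end InverseFunction

/-- `U` is a domain of existence of the holomorphic function `B : U → ℂ`: a germ of `B` at a point
of `U` has no holomorphic extension to a connected open set that leaves `U`. The values of `B`
outside `U` are irrelevant. -/
structure IsDomainOfExistence (B : ℂ → ℂ) (U : Set ℂ) : Prop where
  isOpen : IsOpen U
  differentiableOn : DifferentiableOn ℂ B U
  subset_of_eventuallyEq : ∀ {V : Set ℂ} {g : ℂ → ℂ} {z : ℂ}, IsOpen V → IsPreconnected V →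
    DifferentiableOn ℂ g V → z ∈ U → z ∈ V → g =ᶠ[𝓝 z] B → V ⊆ U

namespace IsDomainOfExistence

variable {B : ℂ → ℂ} {U : Set ℂ}

theorem of_convex_of_frequently_eq_zero (hU : IsOpen U) (hconv : Convex ℝ U)
    (hB : DifferentiableOn ℂ B U) (hne : ∃ z ∈ U, B z ≠ 0)
    (hzero : ∀ p ∈ frontier U, ∃ᶠ z in 𝓝 p, z ∈ U ∧ B z = 0) : IsDomainOfExistence B U := by
  refine ⟨hU, hB, fun {V g z} hV hVc hg hzU hzV hgB x hxV => ?_⟩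
  suffices hVsub : V ⊆ {z | z ∈ U ∧ g =ᶠ[𝓝 z] B} from (hVsub hxV).1
  refine hVc.subset_of_closure_inter_subset (hU.inter isOpen_setOfPred_eventually_nhds)
    ⟨z, hzV, hzU, hgB⟩ ?_
  rintro p ⟨hpcl, hpV⟩
  obtain ⟨r, hr, hrV⟩ := Metric.isOpen_iff.1 hV p hpV
  have hgr : AnalyticOnNhd ℂ g (ball p r) := (hg.mono hrV).analyticOnNhd isOpen_ball
  obtain ⟨q, hqr, hqU, hgBq⟩ := mem_closure_iff.1 hpcl _ isOpen_ball (mem_ball_self hr)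
  have heq : EqOn g B (ball p r ∩ U) :=
    (hgr.mono inter_subset_left).eqOn_of_preconnected_of_eventuallyEq
      ((hB.analyticOnNhd hU).mono inter_subset_right)
      ((convex_ball p r).inter hconv).isPreconnected ⟨hqr, hqU⟩ hgBq
  by_cases hpU : p ∈ U
  · exact ⟨hpU, mem_of_superset ((isOpen_ball.inter hU).mem_nhds ⟨mem_ball_self hr, hpU⟩) heq⟩
  exfalso
  have hfrontier : p ∈ frontier U :=
    ⟨closure_mono (fun x hx => hx.1) hpcl, fun h => hpU (interior_subset h)⟩
  have hgzero : ∃ᶠ w in 𝓝[≠] p, g w = 0 := by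
    rw [frequently_nhdsWithin_iff]
    refine ((hzero p hfrontier).and_eventually (ball_mem_nhds p hr)).mono ?_
    rintro w ⟨⟨hwU, hw0⟩, hwr⟩
    exact ⟨(heq ⟨hwr, hwU⟩).trans hw0, ne_of_mem_of_not_mem hwU hpU⟩
  have hgr0 : EqOn g 0 (ball p r) := hgr.eqOn_zero_of_preconnected_of_frequently_eq_zero
    (convex_ball p r).isPreconnected (mem_ball_self hr) hgzero
  obtain ⟨z₀, hz₀, hB₀⟩ := hne
  refine hB₀ ((hB.analyticOnNhd hU).eqOn_zero_of_preconnected_of_eventuallyEq_zero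
    hconv.isPreconnected hqU ?_ hz₀)
  filter_upwards [(isOpen_ball.inter hU).mem_nhds ⟨hqr, hqU⟩] with w hw
  rw [← heq hw]
  exact hgr0 hw.1

variable (hB : IsDomainOfExistence B U)
include hB

theorem differentiableAt {z : ℂ} (hz : z ∈ U) : DifferentiableAt ℂ B z :=
  hB.differentiableOn.differentiableAt (hB.isOpen.mem_nhds hz)

theorem eqOn_of_eventuallyEq {V : Set ℂ} {g : ℂ → ℂ} {z : ℂ} (hV : IsOpen V)
    (hVc : IsPreconnected V) (hg : DifferentiableOn ℂ g V) (hzU : z ∈ U) (hzV : z ∈ V)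
    (hgB : g =ᶠ[𝓝 z] B) : EqOn g B V := by
  have hVU : V ⊆ U := hB.subset_of_eventuallyEq hV hVc hg hzU hzV hgB
  exact (hg.analyticOnNhd hV).eqOn_of_preconnected_of_eventuallyEq
    ((hB.differentiableOn.mono hVU).analyticOnNhd hV) hVc hzV hgB

theorem mem_and_eventually_comp_eq_of_mem_closure {W : Set ℂ} (hW : IsOpen W) {g : ℂ → ℂ}
    (hg : DifferentiableOn ℂ g W) {x : ℂ} (hx : x ∈ W) (hd : deriv g x ≠ 0)
    (hcl : x ∈ closure {w | g w ∈ U ∧ ∀ᶠ w' in 𝓝 w, B (g w') = w'}) :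
    g x ∈ U ∧ ∀ᶠ w in 𝓝 x, B (g w) = w := by
  obtain ⟨e, hxe, -, rfl, hsymm⟩ := exists_openPartialHomeomorph_of_deriv_ne_zero hg hW hx hd
  obtain ⟨r, hr, hrt⟩ := Metric.isOpen_iff.1 e.open_target _ (e.map_source hxe)
  have hnhds : e.source ∩ e ⁻¹' ball (e x) r ∈ 𝓝 x :=
    (e.isOpen_inter_preimage isOpen_ball).mem_nhds ⟨hxe, mem_ball_self hr⟩
  obtain ⟨y, ⟨hye, hyr⟩, hyU, hBy⟩ := mem_closure_iff_nhds.1 hcl _ hnhds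
  have hsymmB : e.symm =ᶠ[𝓝 (e y)] B := by
    have hcont := e.continuousAt_symm (e.map_source hye)
    rw [ContinuousAt, e.left_inv hye] at hcont
    filter_upwards [hcont.eventually hBy, e.open_target.mem_nhds (hrt hyr)] with z hz hzt
    rw [← hz, e.right_inv hzt]
  have hball : IsPreconnected (ball (e x) r) := (convex_ball _ r).isPreconnected
  refine ⟨hB.subset_of_eventuallyEq isOpen_ball hball (hsymm.mono hrt) hyU hyr hsymmB
    (mem_ball_self hr), ?_⟩
  filter_upwards [hnhds] with w hw
  rw [← hB.eqOn_of_eventuallyEq isOpen_ball hball (hsymm.mono hrt) hyU hyr hsymmB hw.2,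
    e.left_inv hw.1]

/-- The only possible obstruction is a critical point of `g`; it is excluded because the left
inverse `B` of `g` is bounded near `g x`, so that the singularity at `g x` is removable. -/
theorem mem_of_eventually_nhdsNE {g : ℂ → ℂ} {x : ℂ} (hg : AnalyticAt ℂ g x)
    (h : ∀ᶠ w in 𝓝[≠] x, g w ∈ U ∧ B (g w) = w) : g x ∈ U := by
  obtain ⟨r, hr, hrU⟩ := Metric.mem_nhdsWithin_iff.1 h
  have hmap : 𝓝 (g x) ≤ map g (𝓝 x) := by
    refine hg.eventually_constant_or_nhds_le_map_nhds.resolve_left fun hconst => ?_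
    have hne : ∀ᶠ w in 𝓝[≠] x, w ≠ B (g x) :=
      nhdsNE_le_cofinite x (finite_singleton (B (g x))).compl_mem_cofinite
    obtain ⟨w, hw, hwx, hwB⟩ :=
      (hne.and ((hconst.filter_mono nhdsWithin_le_nhds).and h)).exists
    exact hw (hwx ▸ hwB.2.symm)
  obtain ⟨ε, hε, hεg⟩ := Metric.mem_nhds_iff.1 (hmap (image_mem_map (ball_mem_nhds x hr)))
  have hpunctured : ∀ v ∈ ball (g x) ε \ {g x}, v ∈ U ∧ B v ∈ ball x r := by
    rintro v ⟨hv, hvne⟩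
    obtain ⟨w, hw, rfl⟩ := hεg hv
    obtain ⟨hwU, hBw⟩ := hrU ⟨hw, fun hwx => hvne (congrArg g hwx)⟩
    exact ⟨hwU, hBw.symm ▸ hw⟩
  have hbdd : BddAbove (norm ∘ B '' (ball (g x) ε \ {g x})) := by
    refine (isBounded_iff_forall_norm_le.1 (isBounded_ball (x := x) (r := r))).imp fun C hC => ?_
    rintro _ ⟨v, hv, rfl⟩
    exact hC _ (hpunctured v hv).2
  have hext := Complex.differentiableOn_update_limUnder_of_bddAbove (ball_mem_nhds (g x) hε)
    (hB.differentiableOn.mono fun v hv => (hpunctured v hv).1) hbdd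
  obtain ⟨v, hv⟩ : (ball (g x) ε \ {g x}).Nonempty :=
    nonempty_of_mem (sdiff_mem_nhdsWithin_compl (ball_mem_nhds (g x) hε) {g x})
  refine hB.subset_of_eventuallyEq isOpen_ball (convex_ball (g x) ε).isPreconnected hext
    (hpunctured v hv).1 hv.1 ?_ (mem_ball_self hε)
  filter_upwards [isOpen_ne.mem_nhds hv.2] with z hz using Function.update_of_ne hz _ _

theorem mapsTo_and_leftInvOn {W : Set ℂ} (hW : IsOpen W) (hWc : IsPreconnected W) {g : ℂ → ℂ}
    (hg : DifferentiableOn ℂ g W) {w₁ : ℂ} (hw₁ : w₁ ∈ W) (hgw₁ : g w₁ ∈ U)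
    (hBg : ∀ᶠ w in 𝓝 w₁, B (g w) = w) : MapsTo g W U ∧ LeftInvOn B g W := by
  have hd₁ : deriv g w₁ ≠ 0 := (deriv_ne_zero_of_eventually_comp_eq (hB.differentiableAt hgw₁)
    (hg.differentiableAt (hW.mem_nhds hw₁)) hBg).2
  set A := {w | g w ∈ U ∧ ∀ᶠ w' in 𝓝 w, B (g w') = w'}
  have hregular : {w ∈ W | deriv g w ≠ 0} ⊆ A := by
    have hpre := isPreconnected_setOf_ne_zero (hg.deriv hW) hW hWc ⟨w₁, hw₁, hd₁⟩
    have hAW : IsOpen (W ∩ g ⁻¹' U ∩ {w | ∀ᶠ w' in 𝓝 w, B (g w') = w'}) :=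
      (hg.continuousOn.isOpen_inter_preimage hW hB.isOpen).inter isOpen_setOfPred_eventually_nhds
    refine (hpre.subset_of_closure_inter_subset hAW ⟨w₁, ⟨hw₁, hd₁⟩, ⟨hw₁, hgw₁⟩, hBg⟩ ?_).trans
      fun w hw => ⟨hw.1.2, hw.2⟩
    rintro x ⟨hxcl, hxW, hxd⟩
    have hxA := hB.mem_and_eventually_comp_eq_of_mem_closure hW hg hxW hxd
      (closure_mono (t := A) (fun w hw => ⟨hw.1.2, hw.2⟩) hxcl)
    exact ⟨⟨hxW, hxA.1⟩, hxA.2⟩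
  have hnear : ∀ x ∈ W, ∀ᶠ w in 𝓝[≠] x, g w ∈ U ∧ B (g w) = w := by
    intro x hx
    filter_upwards [eventually_nhdsNE_ne_zero_of_isPreconnected (hg.deriv hW) hW hWc
      ⟨w₁, hw₁, hd₁⟩ hx, mem_nhdsWithin_of_mem_nhds (hW.mem_nhds hx)] with w hwd hwW
    exact ⟨(hregular ⟨hwW, hwd⟩).1, (hregular ⟨hwW, hwd⟩).2.self_of_nhds⟩
  have hmem : ∀ x ∈ W, g x ∈ U := fun x hx =>
    hB.mem_of_eventually_nhdsNE (hg.analyticAt (hW.mem_nhds hx)) (hnear x hx)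
  refine ⟨hmem, fun x hx => ?_⟩
  have hcont : ContinuousAt (fun w => B (g w)) x :=
    (hB.differentiableAt (hmem x hx)).continuousAt.comp
      (hg.differentiableAt (hW.mem_nhds hx)).continuousAt
  exact tendsto_nhds_unique (hcont.tendsto.mono_left nhdsWithin_le_nhds)
    ((tendsto_id.mono_left nhdsWithin_le_nhds).congr' ((hnear x hx).mono fun w hw => hw.2.symm))

end IsDomainOfExistence

theorem IsBlaschkeProduct.isDomainOfExistence {a c : ℕ → ℂ} {B : ℂ → ℂ}
    (hB : IsBlaschkeProduct a c B) (ha : ∀ n, ‖a n‖ < 1) (hsum : Summable fun n => 1 - ‖a n‖)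
    (hcluster : ∀ p ∈ sphere (0 : ℂ) 1, MapClusterPt p atTop a) :
    IsDomainOfExistence B (ball 0 1) := by
  obtain ⟨z, hza, hz⟩ : ∃ z ∉ range a, z ∈ ball (0 : ℂ) 1 :=
    ((countable_range a).dense_compl ℝ).exists_mem_open isOpen_ball (nonempty_ball.2 one_pos)
  refine .of_convex_of_frequently_eq_zero isOpen_ball (convex_ball 0 1) (hB.differentiableOn ha)
    ⟨z, hz, ?_⟩ fun p hp => ?_
  · rwa [Ne, hB.apply_eq_zero_iff ha hsum (mem_ball_zero_iff.1 hz)]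
  · rw [frontier_ball 0 one_ne_zero] at hp
    refine frequently_iff.2 fun hV => ?_
    obtain ⟨n, hn⟩ := ((hcluster p hp).frequently hV).exists
    exact ⟨a n, hn, mem_ball_zero_iff.2 (ha n), hB.apply_eq_zero ha n⟩

namespace HolElement

theorem isPreconnected_dom (E : HolElement) : IsPreconnected (E.dom : Set ℂ) := by
  have := E.simplyConnected
  exact isPreconnected_iff_preconnectedSpace.2 inferInstance

/-- The function element of a holomorphic function on a nonempty convex open set, convexity being a
convenient way to ensure simple connectedness. -/
def ofConvex (U : TopologicalSpace.Opens ℂ) (hU : Convex ℝ (U : Set ℂ)) (hne : (U : Set ℂ).Nonempty)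
    (f : ℂ → ℂ) (hf : DifferentiableOn ℂ f U) : HolElement where
  dom := U
  simplyConnected :=
    have : ContractibleSpace U := hU.contractibleSpace hne
    inferInstance
  toFun := f
  holo := hf

theorem analyticAt (E : HolElement) {z : ℂ} (hz : z ∈ E.dom) : AnalyticAt ℂ E.toFun z :=
  E.holo.analyticAt (E.dom.isOpen.mem_nhds hz)

theorem differentiableAt (E : HolElement) {z : ℂ} (hz : z ∈ E.dom) :
    DifferentiableAt ℂ E.toFun z :=
  (E.analyticAt hz).differentiableAt

section Connectable

variable {E E' : HolElement}

theorem Linked.symm (h : Linked E E') : Linked E' E :=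
  ⟨inter_comm (E.dom : Set ℂ) _ ▸ h.1, inter_comm (E.dom : Set ℂ) _ ▸ h.2.symm⟩

theorem Connectable.symm (h : Connectable E E') : Connectable E' E := by
  have : Std.Symm Linked := ⟨fun _ _ => Linked.symm⟩
  exact Relation.ReflTransGen.stdSymm.symm _ _ h

theorem connectable_of_eventuallyEq {p : ℂ} (hp : p ∈ E.dom) (hp' : p ∈ E'.dom)
    (h : E.toFun =ᶠ[𝓝 p] E'.toFun) : Connectable E E' := by
  obtain ⟨r, hr, hsub⟩ := Metric.mem_nhds_iff.1
    (inter_mem (inter_mem (E.dom.isOpen.mem_nhds hp) (E'.dom.isOpen.mem_nhds hp')) h)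
  let X : HolElement := ofConvex ⟨ball p r, isOpen_ball⟩ (convex_ball p r) ⟨p, mem_ball_self hr⟩
    E.toFun (E.holo.mono fun z hz => (hsub hz).1.1)
  have hEX : Linked E X := ⟨⟨p, hp, mem_ball_self hr⟩, fun z _ => rfl⟩
  have hXE' : Linked X E' := ⟨⟨p, mem_ball_self hr, hp'⟩, fun z hz => (hsub hz.1).2⟩
  exact (Relation.ReflTransGen.single hEX).tail hXE'

theorem Connectable.subset_and_eqOn {B : ℂ → ℂ} {U : Set ℂ} (h : Connectable E E')
    (hB : IsDomainOfExistence B U) (hEU : (E.dom : Set ℂ) ⊆ U) (hEB : EqOn E.toFun B E.dom) :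
    (E'.dom : Set ℂ) ⊆ U ∧ EqOn E'.toFun B E'.dom := by
  induction h with
  | refl => exact ⟨hEU, hEB⟩
  | @tail X Y _ hXY ih =>
    obtain ⟨⟨z, hzX, hzY⟩, hXY⟩ := hXY
    have hYB : Y.toFun =ᶠ[𝓝 z] B := by
      filter_upwards [(X.dom.isOpen.inter Y.dom.isOpen).mem_nhds ⟨hzX, hzY⟩] with w hw
      rw [← hXY hw, ih.2 hw.1]
    exact ⟨hB.subset_of_eventuallyEq Y.dom.isOpen Y.isPreconnected_dom Y.holo (ih.1 hzX) hzY hYB,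
      hB.eqOn_of_eventuallyEq Y.dom.isOpen Y.isPreconnected_dom Y.holo (ih.1 hzX) hzY hYB⟩

theorem hasNaturalBoundary_of_isDomainOfExistence {B : ℂ → ℂ} (hB : IsDomainOfExistence B E.dom)
    (hEB : EqOn E.toFun B E.dom) : E.HasNaturalBoundary :=
  fun _ _ hV hVE hVW =>
    (hVW.subset_and_eqOn hB hV fun _ hz => (hVE hz).trans (hEB (hV hz))).1

end Connectable

/-- `E` represents the branch of the inverse of `B` at `B y` with value `y`: the analogue of
`HolElement.IsInverseBranch` at an arbitrary base point, along which branches are continued. -/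
def IsBranchAt (B : ℂ → ℂ) (y : ℂ) (E : HolElement) : Prop :=
  B y ∈ E.dom ∧ E.toFun (B y) = y ∧ ∀ᶠ w in 𝓝 (B y), B (E.toFun w) = w

section Branches

variable {B : ℂ → ℂ} {U : Set ℂ} {x y : ℂ} {E E' : HolElement}

theorem IsInverseBranch.apply_eq_zero (hE : E.IsInverseBranch B x) : B x = 0 :=
  hE.2.1 ▸ hE.2.2.self_of_nhds

theorem IsInverseBranch.isBranchAt (hE : E.IsInverseBranch B x) : E.IsBranchAt B x := by
  rwa [IsBranchAt, hE.apply_eq_zero]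

theorem IsBranchAt.deriv_ne_zero (hE : E.IsBranchAt B y) (hB : DifferentiableAt ℂ B y) :
    deriv B y ≠ 0 := by
  obtain ⟨hdom, hy, hBE⟩ := hE
  simpa only [hy] using
    (deriv_ne_zero_of_eventually_comp_eq (hy.symm ▸ hB) (E.differentiableAt hdom) hBE).1

theorem IsBranchAt.eventuallyEq_symm (hE : E.IsBranchAt B y) {e : OpenPartialHomeomorph ℂ ℂ}
    (he : ⇑e = B) (hy : y ∈ e.source) : E.toFun =ᶠ[𝓝 (B y)] e.symm := by
  subst he
  exact eventuallyEq_symm_of_eventually_comp_eq e hy (E.differentiableAt hE.1).continuousAt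
    hE.2.1 hE.2.2

variable (hB : DifferentiableOn ℂ B U) (hU : IsOpen U)
include hB hU

theorem IsBranchAt.eventuallyEq (hE : E.IsBranchAt B y) (hE' : E'.IsBranchAt B y) (hy : y ∈ U) :
    E.toFun =ᶠ[𝓝 (B y)] E'.toFun := by
  obtain ⟨e, hye, -, heB, -⟩ := exists_openPartialHomeomorph_of_deriv_ne_zero hB hU hy
    (hE.deriv_ne_zero (hB.differentiableAt (hU.mem_nhds hy)))
  exact (hE.eventuallyEq_symm heB hye).trans (hE'.eventuallyEq_symm heB hye).symm

theorem IsInverseBranch.eventuallyEq (hE : E.IsInverseBranch B y) (hE' : E'.IsInverseBranch B y)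
    (hy : y ∈ U) : E.toFun =ᶠ[𝓝 0] E'.toFun := by
  simpa only [hE.apply_eq_zero] using hE.isBranchAt.eventuallyEq hB hU hE'.isBranchAt hy

theorem exists_isBranchAt_and_eventually_connectable (hx : x ∈ U) (hd : deriv B x ≠ 0) :
    ∃ X : HolElement, X.IsBranchAt B x ∧
      ∀ᶠ y in 𝓝 x, ∀ E : HolElement, E.IsBranchAt B y → X.Connectable E := by
  obtain ⟨e, hxe, -, rfl, hsymm⟩ := exists_openPartialHomeomorph_of_deriv_ne_zero hB hU hx hd
  obtain ⟨r, hr, hsub⟩ := Metric.isOpen_iff.1 e.open_target _ (e.map_source hxe)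
  let X : HolElement := ofConvex ⟨ball (e x) r, isOpen_ball⟩ (convex_ball _ r)
    ⟨_, mem_ball_self hr⟩ e.symm (hsymm.mono hsub)
  refine ⟨X, ⟨mem_ball_self hr, e.left_inv hxe, e.eventually_right_inverse' hxe⟩, ?_⟩
  filter_upwards [(e.isOpen_inter_preimage isOpen_ball).mem_nhds ⟨hxe, mem_ball_self hr⟩]
    with y hy E hE
  exact connectable_of_eventuallyEq hy.2 hE.1 (hE.eventuallyEq_symm rfl hy.1).symm

theorem IsBranchAt.connectable (hreg : IsPreconnected {z ∈ U | deriv B z ≠ 0})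
    (hE : E.IsBranchAt B x) (hE' : E'.IsBranchAt B y) (hx : x ∈ U) (hy : y ∈ U) :
    E.Connectable E' := by
  have hlocal := fun x (hx : x ∈ {z ∈ U | deriv B z ≠ 0}) =>
    exists_isBranchAt_and_eventually_connectable hB hU hx.1 hx.2
  refine hreg.induction₂ (fun x y => ∀ E E' : HolElement, E.IsBranchAt B x → E'.IsBranchAt B y →
    E.Connectable E') (fun x hx => ?_) (fun x y z _ hy _ hxy hyz E E' hE hE' => ?_)
    (fun x y _ _ h E E' hE hE' => (h E' E hE' hE).symm)
    ⟨hx, hE.deriv_ne_zero (hB.differentiableAt (hU.mem_nhds hx))⟩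
    ⟨hy, hE'.deriv_ne_zero (hB.differentiableAt (hU.mem_nhds hy))⟩ E E' hE hE'
  · obtain ⟨X, -, hX⟩ := hlocal x hx
    refine (hX.filter_mono nhdsWithin_le_nhds).mono fun y hy E E' hE hE' => ?_
    exact (hX.self_of_nhds E hE).symm.trans (hy E' hE')
  · obtain ⟨X, hX, -⟩ := hlocal y hy
    exact (hxy E X hE hX).trans (hyz X E' hX hE')

theorem IsInverseBranch.connectable (hUc : IsPreconnected U) (hE : E.IsInverseBranch B x)
    (hE' : E'.IsInverseBranch B y) (hx : x ∈ U) (hy : y ∈ U) : E.Connectable E' :=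
  have hd := hE.isBranchAt.deriv_ne_zero (hB.differentiableAt (hU.mem_nhds hx))
  hE.isBranchAt.connectable hB hU (isPreconnected_setOf_ne_zero (hB.deriv hU) hU hUc ⟨x, hx, hd⟩)
    hE'.isBranchAt hx hy

end Branches

end HolElement

theorem taylorRadius_congr {f g : ℂ → ℂ} {z : ℂ} (h : f =ᶠ[𝓝 z] g) :
    taylorRadius f z = taylorRadius g z := by
  simp only [taylorRadius, fun k => h.iteratedDeriv_eq k]

theorem hasFPowerSeriesAt_ofScalars_taylor {f : ℂ → ℂ} {z : ℂ} (hf : AnalyticAt ℂ f z) :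
    HasFPowerSeriesAt f (FormalMultilinearSeries.ofScalars ℂ
      (fun k : ℕ => ((k.factorial : ℂ)⁻¹ * iteratedDeriv k f z))) z := by
  simpa only [div_eq_inv_mul] using hf.hasFPowerSeriesAt

theorem taylorRadius_pos {f : ℂ → ℂ} {z : ℂ} (hf : AnalyticAt ℂ f z) : 0 < taylorRadius f z :=
  (hasFPowerSeriesAt_ofScalars_taylor hf).radius_pos

theorem exists_differentiableOn_eball_taylorRadius {f : ℂ → ℂ} {z : ℂ} (hf : AnalyticAt ℂ f z) :
    ∃ g : ℂ → ℂ, DifferentiableOn ℂ g (eball z (taylorRadius f z)) ∧ g =ᶠ[𝓝 z] f := by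
  have hp := hasFPowerSeriesAt_ofScalars_taylor hf
  have hsum := (FormalMultilinearSeries.hasFPowerSeriesOnBall _ hp.radius_pos).comp_sub z
  rw [zero_add] at hsum
  exact ⟨_, hsum.differentiableOn, hp.eventually_hasSum_sub.mono fun w hw => hw.tsum_eq⟩

namespace HolElement

variable {B : ℂ → ℂ} {U : Set ℂ} {b : ℂ}

theorem IsInverseBranch.exists_leftInvOn_eball {E : HolElement} (hE : E.IsInverseBranch B b)
    (hB : IsDomainOfExistence B U) (hb : b ∈ U) :
    ∃ g : ℂ → ℂ, DifferentiableOn ℂ g (eball 0 (taylorRadius E.toFun 0)) ∧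
      g =ᶠ[𝓝 0] E.toFun ∧ MapsTo g (eball 0 (taylorRadius E.toFun 0)) U ∧
      LeftInvOn B g (eball 0 (taylorRadius E.toFun 0)) := by
  obtain ⟨h0, hE0, hBE⟩ := hE
  obtain ⟨g, hg, hgE⟩ := exists_differentiableOn_eball_taylorRadius (E.analyticAt h0)
  refine ⟨g, hg, hgE, hB.mapsTo_and_leftInvOn isOpen_eball (convex_eball _ _).isPreconnected hg
    (mem_eball_self (taylorRadius_pos (E.analyticAt h0))) ?_ ?_⟩
  · rwa [hgE.self_of_nhds, hE0]
  · filter_upwards [hgE, hBE] with w hgw hBw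
    rw [hgw, hBw]

theorem exists_isInverseBranch_dom_eq_eball (hB : IsDomainOfExistence B U) (hb : b ∈ U)
    (hb0 : B b = 0) (hd : deriv B b ≠ 0) :
    ∃ E : HolElement, E.IsInverseBranch B b ∧
      (E.dom : Set ℂ) = eball 0 (taylorRadius E.toFun 0) ∧
      MapsTo E.toFun E.dom U ∧ InjOn E.toFun E.dom := by
  obtain ⟨X, hX, -⟩ :=
    exists_isBranchAt_and_eventually_connectable hB.differentiableOn hB.isOpen hb hd
  have hX' : X.IsInverseBranch B b := by rwa [IsBranchAt, hb0] at hX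
  obtain ⟨g, hg, hgX, hgU, hBg⟩ := hX'.exists_leftInvOn_eball hB hb
  have hpos : 0 < taylorRadius X.toFun 0 := taylorRadius_pos (X.analyticAt hX'.1)
  refine ⟨ofConvex ⟨_, isOpen_eball⟩ (convex_eball _ _) ⟨0, mem_eball_self hpos⟩ g hg,
    ⟨mem_eball_self hpos, hgX.self_of_nhds.trans hX'.2.1, ?_⟩, ?_, hgU, hBg.injOn⟩
  · filter_upwards [eball_mem_nhds _ hpos] with w hw using hBg hw
  · exact congrArg (eball 0) (taylorRadius_congr hgX).symm

end HolElement

theorem le_norm_of_norm_le_norm_mul_norm {ρ : ℝ} (hρ : 0 < ρ) {u v : ℂ → ℂ}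
    (hu : DifferentiableOn ℂ u (ball 0 ρ)) (hmaps : MapsTo u (ball 0 ρ) (closedBall 0 1))
    (hu0 : u 0 = 0) (hv : ContinuousAt v 0) (h : ∀ w ∈ ball (0 : ℂ) ρ, ‖w‖ ≤ ‖u w‖ * ‖v w‖) :
    ρ ≤ ‖v 0‖ := by
  have hbound : ∀ w ∈ ball (0 : ℂ) ρ, w ≠ 0 → ρ ≤ ‖v w‖ := by
    intro w hw hw0
    have hschwarz : ‖u w‖ ≤ 1 / ρ * ‖w‖ := by
      simpa only [hu0, dist_zero_right] using
        Complex.dist_le_div_mul_dist_of_mapsTo_ball hu (by rwa [hu0]) hw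
    have hle : ‖w‖ * ρ ≤ ‖w‖ * ‖v w‖ := by
      calc ‖w‖ * ρ ≤ ‖u w‖ * ‖v w‖ * ρ := by gcongr; exact h w hw
        _ ≤ 1 / ρ * ‖w‖ * ‖v w‖ * ρ := by gcongr
        _ = ‖w‖ * ‖v w‖ := by field_simp
    exact le_of_mul_le_mul_left hle (norm_pos_iff.2 hw0)
  refine ge_of_tendsto (hv.norm.tendsto.mono_left (nhdsWithin_le_nhds (s := {0}ᶜ))) ?_
  filter_upwards [mem_nhdsWithin_of_mem_nhds (ball_mem_nhds (0 : ℂ) hρ), self_mem_nhdsWithin]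
    with w hw hw0 using hbound w hw hw0

namespace IsBlaschkeProduct

variable {a c : ℕ → ℂ} {B : ℂ → ℂ}

theorem radius_le_of_leftInvOn (hB : IsBlaschkeProduct a c B) (ha : ∀ n, ‖a n‖ < 1) {m n : ℕ}
    (hmn : m ≠ n) {ρ : ℝ} (hρ : 0 < ρ) {g : ℂ → ℂ} (hg : DifferentiableOn ℂ g (ball 0 ρ))
    (hg0 : g 0 = a m) (hmaps : MapsTo g (ball 0 ρ) (ball 0 1)) (hBg : LeftInvOn B g (ball 0 ρ)) :
    ρ ≤ ‖a m - a n‖ / (1 - ‖a m‖) := by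
  refine le_trans ?_ (norm_blaschkeFactor_le_div (ha m) (ha n).le)
  have hcomp : ∀ k, DifferentiableOn ℂ (fun w => blaschkeFactor (a k) (g w)) (ball 0 ρ) :=
    fun k => (differentiableOn_blaschkeFactor (ha k).le).comp hg hmaps
  rw [← hg0]
  refine le_norm_of_norm_le_norm_mul_norm (v := fun w => blaschkeFactor (a n) (g w)) hρ (hcomp m)
    (fun w hw => ?_) (by rw [hg0, blaschkeFactor_self])
    ((hcomp n).continuousOn.continuousAt (ball_mem_nhds 0 hρ)) fun w hw => ?_
  · exact mem_closedBall_zero_iff.2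
      (norm_blaschkeFactor_lt_one (ha m) (mem_ball_zero_iff.1 (hmaps hw))).le
  · simpa only [hBg hw] using hB.norm_le_mul ha (mem_ball_zero_iff.1 (hmaps hw)) hmn

theorem taylorRadius_le (hB : IsBlaschkeProduct a c B) (ha : ∀ n, ‖a n‖ < 1)
    (hdom : IsDomainOfExistence B (ball 0 1)) {m n : ℕ} (hmn : m ≠ n) {E : HolElement}
    (hE : E.IsInverseBranch B (a m)) :
    taylorRadius E.toFun 0 ≤ ENNReal.ofReal (‖a m - a n‖ / (1 - ‖a m‖)) := by
  obtain ⟨g, hg, hgE, hmaps, hBg⟩ :=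
    hE.exists_leftInvOn_eball hdom (mem_ball_zero_iff.2 (ha m))
  refine ENNReal.le_of_forall_nnreal_lt fun ρ hρ => ?_
  rcases eq_or_ne ρ 0 with rfl | hρ0
  · simp
  have hsub : ball (0 : ℂ) ρ ⊆ eball 0 (taylorRadius E.toFun 0) :=
    eball_coe.symm.trans_subset (eball_subset_eball hρ.le)
  rw [← ENNReal.ofReal_coe_nnreal]
  exact ENNReal.ofReal_le_ofReal (hB.radius_le_of_leftInvOn ha hmn (by positivity) (hg.mono hsub)
    (hgE.self_of_nhds.trans hE.2.1) (hmaps.mono_left hsub) (hBg.mono hsub))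

end IsBlaschkeProduct

namespace IsPairedBlaschkeSequence

variable {a c : ℕ → ℂ} {B : ℂ → ℂ} (ha : IsPairedBlaschkeSequence a)
include ha

theorem norm_lt_one (n : ℕ) : ‖a n‖ < 1 :=
  mem_ball_zero_iff.1 (ha.mem_disc n)

theorem norm_even_sub_odd_div_le (n : ℕ) :
    ‖a (2 * n) - a (2 * n + 1)‖ / (1 - ‖a (2 * n)‖) ≤ 1 - ‖a (2 * n)‖ := by
  rw [div_le_iff₀ (sub_pos.2 (ha.norm_lt_one _)), ← sq]
  exact ha.close n

theorem tendsto_one_sub_norm_even : Tendsto (fun n => 1 - ‖a (2 * n)‖) atTop (𝓝 0) :=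
  ha.summable.tendsto_atTop_zero.comp (tendsto_id.const_mul_atTop' two_pos)

variable (hB : IsBlaschkeProduct a c B)
include hB

theorem isDomainOfExistence : IsDomainOfExistence B (ball 0 1) :=
  hB.isDomainOfExistence ha.norm_lt_one ha.summable ha.accumulates

theorem taylorRadius_even_le_div {n : ℕ} {E : HolElement}
    (hE : E.IsInverseBranch B (a (2 * n))) :
    taylorRadius E.toFun 0 ≤
      ENNReal.ofReal (‖a (2 * n) - a (2 * n + 1)‖ / (1 - ‖a (2 * n)‖)) :=
  hB.taylorRadius_le ha.norm_lt_one (ha.isDomainOfExistence hB) (by lia) hE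

theorem taylorRadius_even_le {n : ℕ} {E : HolElement} (hE : E.IsInverseBranch B (a (2 * n))) :
    taylorRadius E.toFun 0 ≤ ENNReal.ofReal (1 - ‖a (2 * n)‖) :=
  (ha.taylorRadius_even_le_div hB hE).trans
    (ENNReal.ofReal_le_ofReal (ha.norm_even_sub_odd_div_le n))

theorem tendsto_taylorRadius_even {E : ℕ → HolElement}
    (hE : ∀ n, (E n).IsInverseBranch B (a n)) :
    Tendsto (fun n => taylorRadius (E (2 * n)).toFun 0) atTop (𝓝 0) :=
  tendsto_of_tendsto_of_tendsto_of_le_of_le tendsto_const_nhds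
    (by simpa using ENNReal.tendsto_ofReal ha.tendsto_one_sub_norm_even) (fun _ => zero_le)
    fun n => ha.taylorRadius_even_le hB (hE (2 * n))

end IsPairedBlaschkeSequence

section LocalDiffeomorph

theorem isLocalDiffeomorphAt_of_deriv_ne_zero {U : Set ℂ} {f : ℂ → ℂ}
    (hf : DifferentiableOn ℂ f U) (hU : IsOpen U) {z : ℂ} (hz : z ∈ U) (hd : deriv f z ≠ 0) :
    IsLocalDiffeomorphAt 𝓘(ℂ) 𝓘(ℂ) ω f z := by
  obtain ⟨e, hze, hsource, rfl, hsymm⟩ := exists_openPartialHomeomorph_of_deriv_ne_zero hf hU hz hd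
  have hfsource := hf.mono fun w hw => (hsource hw).1
  exact ⟨{  toPartialEquiv := e.toPartialEquiv
            open_source := e.open_source
            open_target := e.open_target
            contMDiffOn_toFun := (hfsource.contDiffOn e.open_source).contMDiffOn
            contMDiffOn_invFun := (hsymm.contDiffOn e.open_target).contMDiffOn },
    hze, fun _ _ => rfl⟩

variable {𝕜 E H : Type*} [NontriviallyNormedField 𝕜] [NormedAddCommGroup E] [NormedSpace 𝕜 E]
  [TopologicalSpace H] {I : ModelWithCorners 𝕜 E H} {n : ℕ∞ω}

theorem isLocalDiffeomorph_of_isOpenEmbedding {X : Type*} [TopologicalSpace X] [Nonempty X]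
    {e : X → H} (he : Topology.IsOpenEmbedding e) :
    haveI := he.singletonChartedSpace; IsLocalDiffeomorph I I n e := by
  let := he.singletonChartedSpace
  intro x
  let Φ : PartialDiffeomorph I I X H n :=
    { toPartialEquiv := (he.toOpenPartialHomeomorph e).toPartialEquiv
      open_source := (he.toOpenPartialHomeomorph e).open_source
      open_target := (he.toOpenPartialHomeomorph e).open_target
      contMDiffOn_toFun := (contMDiff_isOpenEmbedding he).contMDiffOn
      contMDiffOn_invFun := by
        simpa using contMDiffOn_isOpenEmbedding_symm (I := I) (n := n) he }
  exact ⟨Φ, mem_univ x, fun _ _ => rfl⟩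

variable {E' H' : Type*} [NormedAddCommGroup E'] [NormedSpace 𝕜 E'] [TopologicalSpace H']
  {I' : ModelWithCorners 𝕜 E' H'} {M N P : Type*} [TopologicalSpace M] [ChartedSpace H' M]
  [TopologicalSpace N] [ChartedSpace H N] [TopologicalSpace P] [ChartedSpace H P]

theorem mdifferentiable_of_isLocalDiffeomorph_comp {φ : M → N} {p : N → P}
    (hp : IsLocalDiffeomorph I I n p) (hn : n ≠ 0) (hφ : Continuous φ)
    (h : MDifferentiable I' I (p ∘ φ)) : MDifferentiable I' I φ := by
  intro x
  have hloc := hp (φ x)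
  refine ((hloc.localInverse_mdifferentiableAt hn).comp x (h x)).congr_of_eventuallyEq ?_
  exact (hφ.continuousAt.eventually hloc.localInverse_eventuallyEq_left).mono fun y hy => hy.symm

end LocalDiffeomorph

namespace RegularContinuation

variable {E : HolElement}

theorem exists_chart (Q : RegularContinuation.{u} E) (s : Q.S) :
    ∃ e : OpenPartialHomeomorph Q.S ℂ, s ∈ e.source ∧ EqOn e Q.proj e.source ∧
      DifferentiableOn ℂ (Q.F ∘ e.symm) e.target ∧ IsPreconnected e.target := by
  obtain ⟨Φ, hs, hΦ⟩ := Q.proj_local s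
  let e₀ := Φ.toOpenPartialHomeomorph
  obtain ⟨r, hr, hrt⟩ := Metric.isOpen_iff.1 e₀.open_target (e₀ s) (e₀.map_source hs)
  let e := (e₀.symm.restrOpen (ball (e₀ s) r) isOpen_ball).symm
  have htarget : e.target = ball (e₀ s) r := inter_eq_right.2 hrt
  have hsource : e.source = e₀.source ∩ e₀ ⁻¹' ball (e₀ s) r := by
    ext x
    simp [e]
  have hsymm : MDifferentiableOn 𝓘(ℂ) 𝓘(ℂ) e₀.symm e.target :=
    (Φ.contMDiffOn_invFun.mdifferentiableOn (by simp)).mono inter_subset_left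
  exact ⟨e, hsource ▸ ⟨hs, mem_ball_self hr⟩, fun x hx => (hΦ (hsource ▸ hx).1).symm,
    mdifferentiableOn_iff_differentiableOn.1 (Q.F_holo.comp_mdifferentiableOn hsymm),
    htarget ▸ (convex_ball _ r).isPreconnected⟩

theorem isOpenEmbedding_incl (Q : RegularContinuation.{u} E) : Topology.IsOpenEmbedding Q.incl := by
  refine Q.proj_local.isLocalHomeomorph.isOpenEmbedding_of_comp ?_ Q.incl_holo.continuous
  rw [show Q.proj ∘ Q.incl = Subtype.val from funext Q.proj_incl]
  exact E.dom.isOpen.isOpenEmbedding_subtypeVal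

theorem eventually_nhds_incl (Q : RegularContinuation.{u} E) {p : ℂ → ℂ → Prop} (z : E.dom)
    (h : ∀ᶠ w in 𝓝 (z : ℂ), p w (E.toFun w)) : ∀ᶠ x in 𝓝 (Q.incl z), p (Q.proj x) (Q.F x) := by
  rw [← Q.isOpenEmbedding_incl.map_nhds_eq, eventually_map]
  filter_upwards [continuous_subtype_val.continuousAt.eventually h] with w hw
  rwa [Q.proj_incl, Q.F_incl]

section LeftInverse

variable {B : ℂ → ℂ} {U : Set ℂ} {Q : RegularContinuation.{u} E}

theorem eventually_comp_symm_eq {e : OpenPartialHomeomorph Q.S ℂ} (he : EqOn e Q.proj e.source)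
    {s : Q.S} (hs : s ∈ e.source) (h : ∀ᶠ x in 𝓝 s, B (Q.F x) = Q.proj x) :
    ∀ᶠ w in 𝓝 (e s), B ((Q.F ∘ e.symm) w) = w := by
  have hsymm : Tendsto e.symm (𝓝 (e s)) (𝓝 s) := by
    simpa only [ContinuousAt, e.left_inv hs] using e.continuousAt_symm (e.map_source hs)
  filter_upwards [hsymm.eventually h, e.open_target.mem_nhds (e.map_source hs)] with w hw hwt
  rw [Function.comp_apply, hw, ← he (e.map_target hwt), e.right_inv hwt]

theorem deriv_ne_zero_of_eventually {s : Q.S} (hB : DifferentiableAt ℂ B (Q.F s))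
    (h : ∀ᶠ x in 𝓝 s, B (Q.F x) = Q.proj x) : deriv B (Q.F s) ≠ 0 := by
  obtain ⟨e, hs, he, hF, -⟩ := Q.exists_chart s
  have hFs : (Q.F ∘ e.symm) (e s) = Q.F s := congrArg Q.F (e.left_inv hs)
  simpa only [hFs] using (deriv_ne_zero_of_eventually_comp_eq (hFs.symm ▸ hB)
    (hF.differentiableAt (e.open_target.mem_nhds (e.map_source hs)))
    (eventually_comp_symm_eq he hs h)).1

variable (hB : IsDomainOfExistence B U)
include hB

theorem source_subset_of_mem_interior {e : OpenPartialHomeomorph Q.S ℂ}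
    (he : EqOn e Q.proj e.source) (hF : DifferentiableOn ℂ (Q.F ∘ e.symm) e.target)
    (hconn : IsPreconnected e.target) {s : Q.S} (hs : s ∈ e.source)
    (hsG : s ∈ interior {x | Q.F x ∈ U ∧ B (Q.F x) = Q.proj x}) :
    e.source ⊆ {x | Q.F x ∈ U ∧ B (Q.F x) = Q.proj x} := by
  have hnear : ∀ᶠ x in 𝓝 s, Q.F x ∈ U ∧ B (Q.F x) = Q.proj x := mem_interior_iff_mem_nhds.1 hsG
  have hFs : (Q.F ∘ e.symm) (e s) ∈ U := by
    simpa only [Function.comp_apply, e.left_inv hs] using hnear.self_of_nhds.1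
  obtain ⟨hmaps, hinv⟩ := hB.mapsTo_and_leftInvOn e.open_target hconn hF (e.map_source hs) hFs
    (eventually_comp_symm_eq he hs (hnear.mono fun _ hx => hx.2))
  intro x hx
  rw [mem_ofPred, ← he hx, ← e.left_inv hx, e.right_inv (e.map_source hx)]
  exact ⟨hmaps (e.map_source hx), hinv (e.map_source hx)⟩

theorem mem_and_apply_eq_proj {z : E.dom} (hz : E.toFun z ∈ U)
    (hBE : ∀ᶠ w in 𝓝 (z : ℂ), B (E.toFun w) = w) (s : Q.S) :
    (Q.F s ∈ U ∧ deriv B (Q.F s) ≠ 0) ∧ B (Q.F s) = Q.proj s := by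
  set G := {x : Q.S | Q.F x ∈ U ∧ B (Q.F x) = Q.proj x}
  have hzG : Q.incl z ∈ interior G := by
    rw [mem_interior_iff_mem_nhds]
    have hU := (E.differentiableAt z.2).continuousAt.eventually (hB.isOpen.mem_nhds hz)
    exact Q.eventually_nhds_incl (p := fun w v => v ∈ U ∧ B v = w) z (hU.and hBE)
  have hG : univ ⊆ interior G := by
    refine isPreconnected_univ.subset_of_closure_inter_subset isOpen_interior
      ⟨Q.incl z, mem_univ _, hzG⟩ fun x hx => ?_
    obtain ⟨e, hxe, he, hF, hconn⟩ := Q.exists_chart x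
    obtain ⟨y, hye, hyG⟩ := mem_closure_iff_nhds.1 hx.1 _ (e.open_source.mem_nhds hxe)
    exact interior_maximal (source_subset_of_mem_interior hB he hF hconn hye hyG) e.open_source hxe
  have hs : ∀ᶠ x in 𝓝 s, Q.F x ∈ U ∧ B (Q.F x) = Q.proj x :=
    mem_interior_iff_mem_nhds.1 (hG (mem_univ s))
  obtain ⟨hsU, hBs⟩ := hs.self_of_nhds
  exact ⟨⟨hsU, deriv_ne_zero_of_eventually (hB.differentiableAt hsU)
    (hs.mono fun _ hx => hx.2)⟩, hBs⟩

end LeftInverse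

section OfIsOpenEmbedding

variable (E) {X : Type u} [TopologicalSpace X] [ConnectedSpace X] {e : X → ℂ}
  (he : Topology.IsOpenEmbedding e) {p : ℂ → ℂ} (hp : DifferentiableOn ℂ p (range e))
  (hd : ∀ z ∈ range e, deriv p z ≠ 0) (hmaps : MapsTo E.toFun E.dom (range e))
  (hinv : LeftInvOn p E.toFun E.dom)

/-- The regular continuation whose total space is the image of an open embedding `e : X → ℂ` and
whose projection is a locally injective left inverse `p` of `E`; the continued function is the
coordinate `e`. The space `X` rather than an open subset of `ℂ` allows for an arbitrary universe. -/
noncomputable def ofIsOpenEmbedding : RegularContinuation.{u} E :=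
  letI := he.singletonChartedSpace
  have hcoord : IsLocalDiffeomorph 𝓘(ℂ) 𝓘(ℂ) ω e := isLocalDiffeomorph_of_isOpenEmbedding he
  have hincl : e ∘ (fun z : E.dom => (hmaps z.2).choose) = E.toFun ∘ Subtype.val :=
    funext fun z => (hmaps z.2).choose_spec
  { S := X
    t2 := he.isEmbedding.t2Space
    manifold := he.isManifold_singleton
    proj := p ∘ e
    proj_local := fun x => (hcoord x).comp 𝓘(ℂ) ℂ
      (isLocalDiffeomorphAt_of_deriv_ne_zero hp he.isOpen_range (mem_range_self x)
        (hd _ (mem_range_self x)))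
    incl := fun z => (hmaps z.2).choose
    incl_holo := by
      have hE : MDifferentiable 𝓘(ℂ) 𝓘(ℂ) (E.toFun ∘ (Subtype.val : E.dom → ℂ)) := fun z =>
        (E.differentiableAt z.2).mdifferentiableAt.comp z
          ((contMDiff_subtype_val (n := 1) z).mdifferentiableAt one_ne_zero)
      refine mdifferentiable_of_isLocalDiffeomorph_comp hcoord (by simp) ?_ (hincl ▸ hE)
      exact he.isEmbedding.continuous_iff.2 (hincl ▸ hE.continuous)
    proj_incl := fun z => (congrArg p (congrFun hincl z)).trans (hinv z.2)
    F := e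
    F_holo := hcoord.mdifferentiable (by simp)
    F_incl := congrFun hincl }

theorem ofIsOpenEmbedding_isMaximal
    (h : ∀ (Q : RegularContinuation.{u} E) (s : Q.S), Q.F s ∈ range e ∧ p (Q.F s) = Q.proj s) :
    (ofIsOpenEmbedding E he hp hd hmaps hinv).IsMaximal := by
  intro Q
  let := he.singletonChartedSpace
  choose φ hφ using fun s => (h Q s).1
  have heφ : e ∘ φ = Q.F := funext hφ
  refine ⟨φ, ?_, fun s => (congrArg p (hφ s)).trans (h Q s).2, fun z => he.injective ?_, hφ⟩
  · exact mdifferentiable_of_isLocalDiffeomorph_comp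
      (isLocalDiffeomorph_of_isOpenEmbedding he : IsLocalDiffeomorph 𝓘(ℂ) 𝓘(ℂ) ω e) (by simp)
      (he.isEmbedding.continuous_iff.2 (heφ ▸ Q.F_holo.continuous)) (heφ ▸ Q.F_holo)
  · rw [hφ, Q.F_incl]
    exact ((ofIsOpenEmbedding E he hp hd hmaps hinv).F_incl z).symm

end OfIsOpenEmbedding

section Maximal

variable {B : ℂ → ℂ} {U : Set ℂ} (hB : IsDomainOfExistence B U) {z : E.dom} (hz : E.toFun z ∈ U)
  (hBE : ∀ᶠ w in 𝓝 (z : ℂ), B (E.toFun w) = w)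
include hB hz hBE

theorem exists_isMaximal_and_range_F_eq (hU : IsPreconnected U) :
    ∃ Q : RegularContinuation.{u} E, Q.IsMaximal ∧ range Q.F = {x ∈ U | deriv B x ≠ 0} := by
  obtain ⟨hmaps, hinv⟩ :=
    hB.mapsTo_and_leftInvOn E.dom.isOpen E.isPreconnected_dom E.holo z.2 hz hBE
  have hderiv : ∀ w ∈ E.dom, deriv B (E.toFun w) ≠ 0 := fun w hw =>
    (deriv_ne_zero_of_eventually_comp_eq (hB.differentiableAt (hmaps hw)) (E.differentiableAt hw)
      (mem_of_superset (E.dom.isOpen.mem_nhds hw) hinv)).1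
  set R := {x ∈ U | deriv B x ≠ 0}
  have hR : IsOpen R := (hB.differentiableOn.deriv hB.isOpen).continuousOn.isOpen_inter_preimage
    hB.isOpen isOpen_compl_singleton
  have hconn : ConnectedSpace R := isConnected_iff_connectedSpace.1
    ⟨⟨E.toFun z, hz, hderiv z z.2⟩, isPreconnected_setOf_ne_zero
      (hB.differentiableOn.deriv hB.isOpen) hB.isOpen hU ⟨E.toFun z, hz, hderiv z z.2⟩⟩
  let e : ULift.{u} R → ℂ := Subtype.val ∘ ULift.down
  have he : Topology.IsOpenEmbedding e :=
    hR.isOpenEmbedding_subtypeVal.comp Homeomorph.ulift.isOpenEmbedding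
  have hrange : range e = R :=
    (ULift.down_surjective.range_comp Subtype.val).trans Subtype.range_coe
  have : ConnectedSpace (ULift.{u} R) :=
    Homeomorph.ulift.symm.surjective.connectedSpace Homeomorph.ulift.symm.continuous
  refine ⟨ofIsOpenEmbedding E he (p := B) ?_ ?_ ?_ hinv,
    ofIsOpenEmbedding_isMaximal E he _ _ _ _ ?_, hrange⟩ <;> rw [hrange]
  · exact hB.differentiableOn.mono fun x hx => hx.1
  · exact fun x hx => hx.2
  · exact fun w hw => ⟨hmaps hw, hderiv w hw⟩
  · exact fun Q s => mem_and_apply_eq_proj hB hz hBE s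

theorem IsMaximal.exists_proj_eq_and_F_eq {Q : RegularContinuation.{u} E} (hQ : Q.IsMaximal)
    (hU : IsPreconnected U) {x : ℂ} (hx : x ∈ U) (hd : deriv B x ≠ 0) :
    ∃ s, Q.proj s = B x ∧ Q.F s = x := by
  obtain ⟨Q', -, hrange⟩ := exists_isMaximal_and_range_F_eq.{u} hB hz hBE hU
  obtain ⟨φ, -, -, -, hφF⟩ := hQ Q'
  obtain ⟨s, hs⟩ : x ∈ range Q'.F := hrange ▸ ⟨hx, hd⟩
  have hFs : Q.F (φ s) = x := (hφF s).trans hs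
  exact ⟨φ s, hFs ▸ (mem_and_apply_eq_proj hB hz hBE (φ s)).2.symm, hFs⟩

end Maximal

section Covering

variable {Q : RegularContinuation.{u} E}

theorem IsCovering.exists_section (hQ : Q.IsCovering) {V : Set ℂ} (hV : IsOpen V)
    [SimplyConnectedSpace V] (hVQ : V ⊆ range Q.proj) {s : Q.S} (hs : Q.proj s ∈ V) :
    ∃ σ : C(V, Q.S), σ ⟨Q.proj s, hs⟩ = s ∧ ∀ w, Q.proj (σ w) = w := by
  have := hV.locallyPathConnectedSpace
  obtain ⟨σ, ⟨hσs, hσ⟩, -⟩ := hQ.existsUnique_continuousMap_lifts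
    ⟨inclusion hVQ, continuous_inclusion hVQ⟩ ⟨Q.proj s, hs⟩ s rfl
  exact ⟨σ, hσs, fun w => congrArg Subtype.val (congrFun hσ w)⟩

theorem IsCovering.exists_leftInvOn (hQ : Q.IsCovering) {B : ℂ → ℂ} {U : Set ℂ}
    (hU : IsOpen U) (hB : DifferentiableOn ℂ B U)
    (hQB : ∀ s, (Q.F s ∈ U ∧ deriv B (Q.F s) ≠ 0) ∧ B (Q.F s) = Q.proj s) {V : Set ℂ}
    (hV : IsOpen V) [SimplyConnectedSpace V] (hVQ : V ⊆ range Q.proj) {s : Q.S}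
    (hs : Q.proj s ∈ V) :
    ∃ g : ℂ → ℂ, DifferentiableOn ℂ g V ∧ g (Q.proj s) = Q.F s ∧ MapsTo g V U ∧
      LeftInvOn B g V := by
  obtain ⟨σ, hσs, hσ⟩ := hQ.exists_section hV hVQ hs
  let g : ℂ → ℂ := Function.extend Subtype.val (fun w => Q.F (σ w)) 0
  have hg : ∀ w : V, g w = Q.F (σ w) := Subtype.val_injective.extend_apply _ _
  have hmaps : ∀ w ∈ V, g w ∈ U ∧ deriv B (g w) ≠ 0 := fun w hw =>
    hg ⟨w, hw⟩ ▸ (hQB (σ ⟨w, hw⟩)).1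
  have hinv : LeftInvOn B g V := fun w hw => by
    rw [hg ⟨w, hw⟩, (hQB _).2, hσ]
  have hcont : ContinuousOn g V := continuousOn_iff_continuous_domRestrict.2
    ((Q.F_holo.continuous.comp σ.continuous).congr fun w => (hg w).symm)
  refine ⟨g, fun w hw => ?_, (hg ⟨_, hs⟩).trans (congrArg Q.F hσs), fun w hw => (hmaps w hw).1,
    hinv⟩
  have hBw := hB.hasDerivAt (hU.mem_nhds (hmaps w hw).1)
  exact (HasDerivAt.of_local_left_inverse (hcont.continuousAt (hV.mem_nhds hw)) hBw
    (hmaps w hw).2 (mem_of_superset (hV.mem_nhds hw) hinv)).differentiableAt.differentiableWithinAt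

end Covering

end RegularContinuation

namespace IsPairedBlaschkeSequence

variable {a c : ℕ → ℂ} {B : ℂ → ℂ} (ha : IsPairedBlaschkeSequence a)
  (hB : IsBlaschkeProduct a c B) {E : HolElement} {n : ℕ} (hE : E.IsInverseBranch B (a n))
include ha hB hE

theorem exists_isMaximal : ∃ Q : RegularContinuation.{u} E, Q.IsMaximal := by
  have hE0 : E.toFun 0 ∈ ball (0 : ℂ) 1 := hE.2.1 ▸ ha.mem_disc n
  obtain ⟨Q, hQ, -⟩ := RegularContinuation.exists_isMaximal_and_range_F_eq
    (ha.isDomainOfExistence hB) (z := ⟨0, hE.1⟩) hE0 hE.2.2 (convex_ball 0 1).isPreconnected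
  exact ⟨Q, hQ⟩

theorem not_isCovering {Q : RegularContinuation.{u} E} (hQ : Q.IsMaximal) : ¬ Q.IsCovering := by
  intro hcov
  have hdom := ha.isDomainOfExistence hB
  have hE0 : E.toFun 0 ∈ ball (0 : ℂ) 1 := hE.2.1 ▸ ha.mem_disc n
  have hzeros : ∀ k, ∃ s : Q.S, Q.proj s = 0 ∧ Q.F s = a k := fun k => by
    simpa only [hB.apply_eq_zero ha.norm_lt_one] using
      hQ.exists_proj_eq_and_F_eq hdom (z := ⟨0, hE.1⟩) hE0 hE.2.2 (convex_ball 0 1).isPreconnected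
        (ha.mem_disc k) (hB.deriv_ne_zero ha.norm_lt_one ha.summable ha.injective k)
  choose s hs0 hsF using hzeros
  obtain ⟨ρ, hρ, hsub⟩ := Metric.isOpen_iff.1 Q.proj_local.isOpen_range 0 ⟨s 0, hs0 0⟩
  have : ContractibleSpace (ball (0 : ℂ) ρ) :=
    (convex_ball 0 ρ).contractibleSpace (nonempty_ball.2 hρ)
  have hbound : ∀ k, ρ ≤ 1 - ‖a (2 * k)‖ := by
    intro k
    obtain ⟨g, hg, hgs, hmaps, hinv⟩ := hcov.exists_leftInvOn hdom.isOpen hdom.differentiableOn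
      (RegularContinuation.mem_and_apply_eq_proj hdom (z := ⟨0, hE.1⟩) hE0 hE.2.2) isOpen_ball hsub
      (s := s (2 * k)) (by rw [hs0]; exact mem_ball_self hρ)
    rw [hs0, hsF] at hgs
    exact (hB.radius_le_of_leftInvOn ha.norm_lt_one (n := 2 * k + 1) (by lia) hρ hg hgs hmaps
      hinv).trans (ha.norm_even_sub_odd_div_le k)
  exact hρ.not_ge (ge_of_tendsto' ha.tendsto_one_sub_norm_even hbound)

end IsPairedBlaschkeSequence

theorem mainTheorem1 :
    (∃ a : ℕ → ℂ, IsPairedBlaschkeSequence a) ∧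
    ∀ a : ℕ → ℂ, IsPairedBlaschkeSequence a →
      (∃ B : ℂ → ℂ, IsBlaschkeProduct a (fun n => blaschkeConst (a n)) B) ∧
      ∀ (c : ℕ → ℂ) (B : ℂ → ℂ), IsBlaschkeProduct a c B →
        -- `B` is a holomorphic self-map of the disc whose zeros are exactly the `a n`, all simple
        DifferentiableOn ℂ B (Metric.ball 0 1) ∧
        Set.MapsTo B (Metric.ball 0 1) (Metric.ball 0 1) ∧
        (∀ z ∈ Metric.ball (0 : ℂ) 1, B z = 0 ↔ ∃ n, a n = z) ∧
        (∀ n, deriv B (a n) ≠ 0) ∧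
        -- the unit circle is a natural boundary of `B`
        (∀ D : HolElement, (D.dom : Set ℂ) = Metric.ball 0 1 →
          Set.EqOn D.toFun B (Metric.ball 0 1) → D.HasNaturalBoundary) ∧
        -- the branch `f n` exists on its disc of convergence, and maps it injectively into the disc
        (∀ n, ∃ E : HolElement, E.IsInverseBranch B (a n) ∧
          (E.dom : Set ℂ) = Metric.eball 0 (taylorRadius E.toFun 0) ∧
          Set.MapsTo E.toFun E.dom (Metric.ball 0 1) ∧ Set.InjOn E.toFun E.dom) ∧
        -- its germ at `0` is unique
        (∀ n, ∀ E E' : HolElement, E.IsInverseBranch B (a n) → E'.IsInverseBranch B (a n) →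
          E.toFun =ᶠ[𝓝 0] E'.toFun) ∧
        -- all branches are connectable
        (∀ m n, ∀ E E' : HolElement, E.IsInverseBranch B (a m) → E'.IsInverseBranch B (a n) →
          E.Connectable E') ∧
        -- bounds on the radii of convergence `r (2 * n)`, which tend to `0`
        (∀ n, ∀ E : HolElement, E.IsInverseBranch B (a (2 * n)) →
          taylorRadius E.toFun 0 ≤
            ENNReal.ofReal (4 * ‖a (2 * n) - a (2 * n + 1)‖ / (1 - ‖a (2 * n)‖)) ∧
          taylorRadius E.toFun 0 ≤ ENNReal.ofReal (4 * (1 - ‖a (2 * n)‖))) ∧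
        (∀ E : ℕ → HolElement, (∀ n, (E n).IsInverseBranch B (a n)) →
          Filter.Tendsto (fun n => taylorRadius (E (2 * n)).toFun 0) Filter.atTop (𝓝 0)) ∧
        -- the maximal continuation exists and its projection is not a covering of its image
        (∀ n, ∀ E : HolElement, E.IsInverseBranch B (a n) →
          (∃ Q : RegularContinuation.{u} E, Q.IsMaximal) ∧
          ∀ Q : RegularContinuation.{u} E, Q.IsMaximal → ¬ Q.IsCovering) := by
  refine ⟨exists_isPairedBlaschkeSequence, fun a ha =>
    ⟨exists_isBlaschkeProduct ha.norm_lt_one ha.summable, fun c B hB => ?_⟩⟩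
  have hlt := ha.norm_lt_one
  have hdom := ha.isDomainOfExistence hB
  have hdisc : IsPreconnected (ball (0 : ℂ) 1) := (convex_ball 0 1).isPreconnected
  have hderiv := hB.deriv_ne_zero hlt ha.summable ha.injective
  refine ⟨hB.differentiableOn hlt, hB.mapsTo_ball hlt,
    fun z hz => hB.apply_eq_zero_iff hlt ha.summable (mem_ball_zero_iff.1 hz), hderiv,
    fun D hD hDB => HolElement.hasNaturalBoundary_of_isDomainOfExistence (hD ▸ hdom) (hD ▸ hDB),
    fun n => HolElement.exists_isInverseBranch_dom_eq_eball hdom (ha.mem_disc n)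
      (hB.apply_eq_zero hlt n) (hderiv n),
    fun n E E' hE hE' => hE.eventuallyEq hdom.differentiableOn hdom.isOpen hE' (ha.mem_disc n),
    fun m n E E' hE hE' => hE.connectable hdom.differentiableOn hdom.isOpen hdisc hE'
      (ha.mem_disc m) (ha.mem_disc n),
    fun n E hE => ⟨?_, ?_⟩, fun E hE => ha.tendsto_taylorRadius_even hB hE,
    fun n E hE => ⟨ha.exists_isMaximal hB hE, fun Q hQ => ha.not_isCovering hB hE hQ⟩⟩
  · refine (ha.taylorRadius_even_le_div hB hE).trans (ENNReal.ofReal_le_ofReal ?_)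
    rw [mul_div_assoc]
    exact le_mul_of_one_le_left
      (div_nonneg (norm_nonneg _) (sub_nonneg.2 (hlt _).le)) (by norm_num)
  · exact (ha.taylorRadius_even_le hB hE).trans (ENNReal.ofReal_le_ofReal
      (le_mul_of_one_le_left (sub_nonneg.2 (hlt _).le) (by norm_num)))
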